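/- Let $n\ge 1$ and $d\ge 2$. Let $\Delta_{d-1}=\operatorname{conv}(e_1,\dots,e_d)\subset\mathbb{R}^d$ be the standard simplex and let $n\Delta_{d-1}$ be the Minkowski sum of $n$ copies of it. A *fine mixed cell* of $n\Delta_{d-1}$ is a Minkowski sum $B_1+\cdots+B_n$ of nonempty faces $B_i$ of $\Delta_{d-1}$ that lie in independent affine subspaces and whose dimensions add up to $d-1$. A *fine mixed subdivision* of $n\Delta_{d-1}$ is a set of fine mixed cells (its *tiles*) whose union is $n\Delta_{d-1}$ and such that the intersection of any two of them is a (possibly empty) face of both. For $k\ge 0$ let $T_{k,d}=\{x\in\mathbb{Z}_{\ge 0}^d : x_1+\cdots+x_d=k-1\}$. Let $\mathcal{T}_{n,d}$ be the matroid on the ground set $T_{n,d}$ whose independent sets are the subsets $I\subseteq T_{n,d}$ such that, for every $k\le n$, every parallel translate of $T_{k,d}$ contained in $\mathbb{Z}_{\ge 0}^d$ contains at most $k$ points of $I$. Then in every fine mixed subdivision of $n\Delta_{d-1}$: (a) exactly $n$ of the tiles are simplices; (b) each tile that is a simplex is a translate $x+\Delta_{d-1}$ for a unique $x\in\mathbb{Z}_{\ge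 0}^d$, called its location, and the set of locations of the $n$ simplex tiles is a basis of the matroid $\mathcal{T}_{n,d}$. -/

import Mathlib

open scoped Pointwise

/-- The ground set `T_{n,d}`: lattice points of `{x ∈ ℝ^d | x ≥ 0, ∑ x_i = n - 1}`
(empty for `n = 0`). -/
def simplexPoints (n d : ℕ) : Set (Fin d → ℕ) := {x | ∑ i, x i + 1 = n}

/-- `I ⊆ T_{n,d}` is independent if every parallel translate of `T_{k,d}` contains at most `k`
points of `I`, for every `k ≤ n`. (All translates contained in the nonnegative orthant are
translates by vectors of natural numbers.) -/
def SimplexIndep (n d : ℕ) (I : Set (Fin d → ℕ)) : Prop :=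
  I ⊆ simplexPoints n d ∧
    ∀ k ≤ n, ∀ v : Fin d → ℕ, (I ∩ (v +ᵥ simplexPoints k d)).ncard ≤ k

theorem simplexPoints_finite (n d : ℕ) : (simplexPoints n d).Finite := by
  refine (Set.finite_Iic (fun _ : Fin d => n)).subset fun x hx i => ?_
  have h1 : x i ≤ ∑ j, x j := Finset.single_le_sum (fun _ _ => Nat.zero_le _) (Finset.mem_univ i)
  have h2 : ∑ j, x j + 1 = n := hx
  show x i ≤ n
  omega

theorem mem_vadd_simplexPoints {n d k : ℕ} {v x : Fin d → ℕ} (hx : x ∈ simplexPoints n d) :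
    x ∈ v +ᵥ simplexPoints k d ↔ v ≤ x ∧ ∑ i, v i + k = n := by
  have hx' : ∑ i, x i + 1 = n := hx
  constructor
  · rintro ⟨y, hy, rfl⟩
    have hy' : ∑ i, y i + 1 = k := hy
    refine ⟨fun i => Nat.le_add_right _ _, ?_⟩
    simp only [vadd_eq_add, Pi.add_apply, Finset.sum_add_distrib] at hx'
    omega
  · rintro ⟨hv, hk⟩
    refine ⟨x - v, ?_, ?_⟩
    · have h : ∑ i, v i + ∑ i, (x - v) i = ∑ i, x i := by
        rw [← Finset.sum_add_distrib]
        exact Finset.sum_congr rfl fun i _ => by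
          have : v i ≤ x i := hv i
          simp only [Pi.sub_apply]; omega
      show ∑ i, (x - v) i + 1 = k
      omega
    · funext i
      have : v i ≤ x i := hv i
      simp only [vadd_eq_add, Pi.add_apply, Pi.sub_apply]
      omega

/-- Independence in terms of the sub-simplices `{x ∈ T_{n,d} | v ≤ x}`. -/
theorem SimplexIndep.ncard_le {n d : ℕ} {I : Set (Fin d → ℕ)} (hI : SimplexIndep n d I)
    (v : Fin d → ℕ) : (I ∩ Set.Ici v).ncard ≤ n - ∑ i, v i := by
  by_cases hv : ∑ i, v i ≤ n
  · refine le_trans (le_of_eq ?_) (hI.2 (n - ∑ i, v i) (Nat.sub_le _ _) v)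
    congr 1
    ext x
    refine and_congr_right fun hx => ?_
    rw [mem_vadd_simplexPoints (hI.1 hx), Set.mem_Ici]
    exact ⟨fun h => ⟨h, by omega⟩, fun h => h.1⟩
  · have : I ∩ Set.Ici v = ∅ := by
      ext x
      simp only [Set.mem_inter_iff, Set.mem_Ici, Set.mem_empty_iff_false, iff_false, not_and]
      intro hx hvx
      have h1 : ∑ i, x i + 1 = n := hI.1 hx
      have h2 : ∑ i, v i ≤ ∑ i, x i := Finset.sum_le_sum fun i _ => hvx i
      omega
    simp [this]

theorem simplexIndep_of_ncard_le {n d : ℕ} {I : Set (Fin d → ℕ)} (hI : I ⊆ simplexPoints n d)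
    (h : ∀ v : Fin d → ℕ, (I ∩ Set.Ici v).ncard ≤ n - ∑ i, v i) : SimplexIndep n d I := by
  refine ⟨hI, fun k _ v => ?_⟩
  by_cases hv : ∑ i, v i + k = n
  · refine le_trans (Set.ncard_le_ncard ?_ (((simplexPoints_finite n d).subset hI).inter_of_left _))
      ((h v).trans (by omega))
    exact fun x hx => ⟨hx.1, ((mem_vadd_simplexPoints (hI hx.1)).1 hx.2).1⟩
  · have : I ∩ (v +ᵥ simplexPoints k d) = ∅ := by
      ext x
      simp only [Set.mem_inter_iff, Set.mem_empty_iff_false, iff_false, not_and]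
      exact fun hx hx' => hv ((mem_vadd_simplexPoints (hI hx)).1 hx').2
    simp [this]

/-- Saturated sub-simplices that share a point of `T_{n,d}` have a saturated join. -/
theorem SimplexIndep.saturated_inf {n d : ℕ} {I : Set (Fin d → ℕ)} (hI : SimplexIndep n d I)
    {v w x : Fin d → ℕ} (hx : x ∈ simplexPoints n d) (hv : v ≤ x) (hw : w ≤ x)
    (sv : (I ∩ Set.Ici v).ncard = n - ∑ i, v i) (sw : (I ∩ Set.Ici w).ncard = n - ∑ i, w i) :
    (I ∩ Set.Ici (v ⊓ w)).ncard = n - ∑ i, (v ⊓ w) i := by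
  have hfin : I.Finite := (simplexPoints_finite n d).subset hI.1
  have hx' : ∑ i, x i + 1 = n := hx
  have h1 := hI.ncard_le (v ⊓ w)
  have h2 := hI.ncard_le (v ⊔ w)
  have h3 := Set.ncard_inter_add_ncard_union (I ∩ Set.Ici v) (I ∩ Set.Ici w)
    (hfin.inter_of_left _) (hfin.inter_of_left _)
  have h4 : (I ∩ Set.Ici v) ∩ (I ∩ Set.Ici w) = I ∩ Set.Ici (v ⊔ w) := by
    ext y; simp only [Set.mem_inter_iff, Set.mem_Ici, sup_le_iff]; tauto
  have h5 : ((I ∩ Set.Ici v) ∪ (I ∩ Set.Ici w)).ncard ≤ (I ∩ Set.Ici (v ⊓ w)).ncard := by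
    refine Set.ncard_le_ncard ?_ (hfin.inter_of_left _)
    rintro y (⟨hy, hvy⟩ | ⟨hy, hwy⟩)
    · exact ⟨hy, le_trans (inf_le_left : v ⊓ w ≤ v) hvy⟩
    · exact ⟨hy, le_trans (inf_le_right : v ⊓ w ≤ w) hwy⟩
  rw [h4] at h3
  have h6 : ∑ i, (v ⊔ w) i + ∑ i, (v ⊓ w) i = ∑ i, v i + ∑ i, w i := by
    rw [← Finset.sum_add_distrib, ← Finset.sum_add_distrib]
    exact Finset.sum_congr rfl fun i _ => by simp only [Pi.sup_apply, Pi.inf_apply]; omega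
  have h7 : ∑ i, (v ⊔ w) i ≤ ∑ i, x i := Finset.sum_le_sum fun i _ => sup_le (hv i) (hw i)
  have h8 : ∑ i, v i ≤ ∑ i, x i := Finset.sum_le_sum fun i _ => hv i
  have h9 : ∑ i, w i ≤ ∑ i, x i := Finset.sum_le_sum fun i _ => hw i
  omega

/-- The augmentation axiom. -/
theorem SimplexIndep.aug {n d : ℕ} {I J : Set (Fin d → ℕ)} (hI : SimplexIndep n d I)
    (hJ : SimplexIndep n d J) (hIJ : I.ncard < J.ncard) :
    ∃ e ∈ J, e ∉ I ∧ SimplexIndep n d (insert e I) := by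
  classical
  by_contra! hcon
  have hfI : I.Finite := (simplexPoints_finite n d).subset hI.1
  have hfJ : J.Finite := (simplexPoints_finite n d).subset hJ.1
  -- each point of `J \ I` lies in a saturated sub-simplex, which we choose largest possible
  have key : ∀ e, e ∈ J \ I → ∃ v : Fin d → ℕ, (v ≤ e ∧ (I ∩ Set.Ici v).ncard = n - ∑ i, v i) ∧
      ∀ w : Fin d → ℕ, w ≤ e → (I ∩ Set.Ici w).ncard = n - ∑ i, w i → w ≤ v → w = v := by
    intro e he
    have hne : ∃ v : Fin d → ℕ, v ≤ e ∧ (I ∩ Set.Ici v).ncard = n - ∑ i, v i := by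
      by_contra! hno
      refine hcon e he.1 he.2 (simplexIndep_of_ncard_le
        (Set.insert_subset (hJ.1 he.1) hI.1) fun v => ?_)
      by_cases hve : v ≤ e
      · have h1 := lt_of_le_of_ne (hI.ncard_le v) (hno v hve)
        rw [Set.insert_inter_of_mem (show e ∈ Set.Ici v from hve)]
        exact (Set.ncard_insert_le _ _).trans h1
      · rw [Set.insert_inter_of_notMem (show e ∉ Set.Ici v from hve)]
        exact hI.ncard_le v
    obtain ⟨v, hv, hmin⟩ := WellFounded.has_min (wellFounded_lt (α := Fin d → ℕ))
      {v | v ≤ e ∧ (I ∩ Set.Ici v).ncard = n - ∑ i, v i} hne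
    exact ⟨v, hv, fun w h1 h2 h3 => eq_of_le_of_not_lt h3 (hmin w ⟨h1, h2⟩)⟩
  choose! m hm hmin using key
  set V : Finset (Fin d → ℕ) := (hfJ.subset Set.sdiff_subset).toFinset.image m with hV
  have hVmem : ∀ v ∈ V, ∃ e ∈ J \ I, m e = v := by
    intro v hv
    simpa [hV] using hv
  have hdisj : ∀ v ∈ V, ∀ w ∈ V, ∀ x ∈ simplexPoints n d, v ≤ x → w ≤ x → v = w := by
    intro v hv w hw x hx hvx hwx
    obtain ⟨e, he, rfl⟩ := hVmem v hv
    obtain ⟨f, hf, rfl⟩ := hVmem w hw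
    have hs := hI.saturated_inf hx hvx hwx (hm e he).2 (hm f hf).2
    exact (hmin e he _ (inf_le_left.trans (hm e he).1) hs inf_le_left).symm.trans
      (hmin f hf _ (inf_le_right.trans (hm f hf).1) hs inf_le_right)
  set U : Set (Fin d → ℕ) := ⋃ v ∈ V, Set.Ici v with hU
  have hcount : ∀ K : Set (Fin d → ℕ), K ⊆ simplexPoints n d →
      (K ∩ U).ncard = ∑ v ∈ V, (K ∩ Set.Ici v).ncard := by
    intro K hK
    have hfK : K.Finite := (simplexPoints_finite n d).subset hK
    have h1 : ∀ A : Set (Fin d → ℕ), (K ∩ A).ncard = (hfK.toFinset.filter (· ∈ A)).card := by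
      intro A
      rw [← Set.ncard_coe_finset]
      congr 1
      ext y; simp
    have h2 : hfK.toFinset.filter (· ∈ U) =
        V.biUnion fun v => hfK.toFinset.filter (· ∈ Set.Ici v) := by
      ext y; simp only [hU, Finset.mem_filter, Finset.mem_biUnion, Set.mem_iUnion,
        Set.Finite.mem_toFinset, exists_prop]; tauto
    rw [h1, h2, Finset.card_biUnion]
    · exact Finset.sum_congr rfl fun v _ => (h1 _).symm
    · intro v hv w hw hvw
      rw [Function.onFun, Finset.disjoint_left]
      intro y hy hy'
      simp only [Finset.mem_filter, Set.Finite.mem_toFinset, Set.mem_Ici] at hy hy'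
      exact hvw (hdisj v hv w hw y (hK hy.1) hy.2 hy'.2)
  have hle : (J ∩ U).ncard ≤ (I ∩ U).ncard := by
    rw [hcount J hJ.1, hcount I hI.1]
    refine Finset.sum_le_sum fun v hv => ?_
    obtain ⟨e, he, rfl⟩ := hVmem v hv
    rw [(hm e he).2]
    exact hJ.ncard_le _
  have hle' : (J \ U).ncard ≤ (I \ U).ncard := by
    refine Set.ncard_le_ncard ?_ (hfI.subset Set.sdiff_subset)
    rintro y ⟨hyJ, hyU⟩
    refine ⟨?_, hyU⟩
    by_contra hyI
    refine hyU ?_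
    rw [hU, Set.mem_iUnion₂]
    exact ⟨m y, Finset.mem_image_of_mem _ (by simpa using ⟨hyJ, hyI⟩), (hm y ⟨hyJ, hyI⟩).1⟩
  have e1 := Set.ncard_inter_add_ncard_sdiff_eq_ncard I U hfI
  have e2 := Set.ncard_inter_add_ncard_sdiff_eq_ncard J U hfJ
  omega

/-- The matroid `𝒯_{n,d}` on the ground set `T_{n,d}`. -/
def simplexMatroid (n d : ℕ) : Matroid (Fin d → ℕ) :=
  (IndepMatroid.ofFinite (simplexPoints_finite n d) (SimplexIndep n d)
    ⟨Set.empty_subset _, fun k _ v => by simp⟩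
    (fun _ _ hJ hIJ => ⟨hIJ.trans hJ.1, fun k hk v => le_trans
      (Set.ncard_le_ncard (Set.inter_subset_inter_left _ hIJ)
        (((simplexPoints_finite n d).subset hJ.1).inter_of_left _)) (hJ.2 k hk v)⟩)
    (fun _ _ hI hJ h => hI.aug hJ h)
    (fun _ hI => hI.1)).matroid

/-- The face of the standard simplex `Δ_{d-1} ⊆ ℝ^d` spanned by the vertices `e_j`, `j ∈ A`. -/
def simplexFace {d : ℕ} (A : Finset (Fin d)) : Set (Fin d → ℝ) :=
  convexHull ℝ ((fun j => Pi.single j (1 : ℝ)) '' (A : Set (Fin d)))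

/-- The Minkowski sum `nΔ_{d-1}` of `n` copies of `Δ_{d-1}`. -/
def dilatedSimplex (n d : ℕ) : Set (Fin d → ℝ) :=
  ∑ _i : Fin n, stdSimplex ℝ (Fin d)

/-- `C` is a fine mixed cell of `nΔ_{d-1}`: a Minkowski sum `B_1 + ⋯ + B_n` of nonempty faces of
`Δ_{d-1}` that lie in independent affine subspaces and whose dimensions add up to `d - 1`. -/
def IsFineMixedCell (n d : ℕ) (C : Set (Fin d → ℝ)) : Prop :=
  ∃ A : Fin n → Finset (Fin d),
    (∀ i, (A i).Nonempty) ∧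
    iSupIndep (fun i => vectorSpan ℝ (simplexFace (A i))) ∧
    ∑ i, Module.finrank ℝ (vectorSpan ℝ (simplexFace (A i))) + 1 = d ∧
    C = ∑ i, simplexFace (A i)

/-- A fine mixed subdivision of `nΔ_{d-1}`: a set of fine mixed cells that cover `nΔ_{d-1}` such
that the intersection of any two of them is a (possibly empty) face of both. The faces of a
polytope are its exposed subsets, where the empty set and the polytope itself are allowed. -/
structure IsFineMixedSubdivision (n d : ℕ) (S : Set (Set (Fin d → ℝ))) : Prop where
  cell : ∀ C ∈ S, IsFineMixedCell n d C
  cover : ⋃₀ S = dilatedSimplex n d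
  face : ∀ C ∈ S, ∀ D ∈ S, IsExposed ℝ C (C ∩ D) ∧ IsExposed ℝ D (C ∩ D)

/-- `C` is a simplex: the convex hull of finitely many (at least one) affinely independent
points. -/
def IsSimplexTile {d : ℕ} (C : Set (Fin d → ℝ)) : Prop :=
  ∃ (k : ℕ) (s : Affine.Simplex ℝ (Fin d → ℝ) k), C = convexHull ℝ (Set.range s.points)

/-- The lattice point `x` is the location of the tile `C`: `C` is the translate `x + Δ_{d-1}`. -/
def HasLocation {d : ℕ} (C : Set (Fin d → ℝ)) (x : Fin d → ℕ) : Prop :=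
  C = (fun i => (x i : ℝ)) +ᵥ stdSimplex ℝ (Fin d)

/-! The proof counts, for every vertex set `B` with at least two elements, the translates `u + Δ_B`
that occur as faces of tiles. `facesAbove n S B v` collects those with `u ≥ v` and `u i = v i` for
`i ∉ B`. When `B` is everything these are the locations of simplex tiles above `v` (`locations_eq`,
`facesAbove_univ_inter_Ici`), so two counts suffice: at most `n - ∑ v i` above each `v`, which is
independence, and at least `n` above `0`, which makes the set a basis.

Both counts start from `B = {a, b}`: the segments lie on one line, and for `v = 0` they fill an edge
of the dilated simplex. Then `B` grows by one vertex `c` at a time. With the coordinates outside `B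
∪ {c}` fixed as in `v`, let `L_h` be the number of translates of `Δ_B` above `v` with `u c = h`, and
`N_h` the number of those of `Δ_{B ∪ c}`. Leaving a translate of `Δ_B` at level `h + 1` in the
direction away from `e_c` leads into a tile with a parallel face at level `h` (`exists_lower`). This
assignment is injective (`upper_unique`) and misses the faces that extend to `Δ_{B ∪ c}`
(`not_hasFace_insert`), so `N_h + L_{h+1} ≤ L_h`; summing over `h ≥ v c` shows that adding `c` does
not increase the count. For `v = 0`, moving towards `e_c` (`exists_upper`, `lower_unique`) gives the
opposite inequality.

The geometric input is that minimal faces of a common point in two tiles agree (`exists_decomp`,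
`faceAt_transfer`). Independence makes the decomposition of a point into summands unique, so points
can be compared summand by summand. -/

/-! ### Minkowski sums of faces in coordinates, and common points of tiles -/

section Basics

variable {n d : ℕ}

theorem mem_simplexFace {A : Finset (Fin d)} {x : Fin d → ℝ} :
    x ∈ simplexFace A ↔ (∀ i, 0 ≤ x i) ∧ (∀ i ∉ A, x i = 0) ∧ ∑ i, x i = 1 := by
  constructor
  · intro hx
    have hconv : Convex ℝ {x : Fin d → ℝ | (∀ i, 0 ≤ x i) ∧ (∀ i ∉ A, x i = 0) ∧ ∑ i, x i = 1} := by
      rintro x ⟨h1, h2, h3⟩ y ⟨k1, k2, k3⟩ a b ha hb hab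
      refine ⟨fun i => ?_, fun i hi => ?_, ?_⟩
      · have := h1 i; have := k1 i
        simp only [Pi.add_apply, Pi.smul_apply, smul_eq_mul]; positivity
      · simp [h2 i hi, k2 i hi]
      · simp [Finset.sum_add_distrib, ← Finset.mul_sum, h3, k3, hab]
    refine convexHull_min ?_ hconv hx
    rintro _ ⟨j, hj, rfl⟩
    refine ⟨fun i => ?_, fun i hi => ?_, by simp⟩
    · by_cases h : i = j
      · subst h; simp
      · simp [h]
    · have : i ≠ j := by rintro rfl; exact hi hj
      simp [this]
  · rintro ⟨h1, h2, h3⟩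
    have hA : ∑ i ∈ A, x i = 1 := by
      rw [← h3]; exact Finset.sum_subset (Finset.subset_univ _) fun i _ hi => h2 i hi
    have hx : x = ∑ i ∈ A, x i • (Pi.single i (1 : ℝ) : Fin d → ℝ) := by
      funext k
      simp only [Finset.sum_apply, Pi.smul_apply, smul_eq_mul, Pi.single_apply, mul_ite, mul_one,
        mul_zero, Finset.sum_ite_eq]
      split_ifs with hk
      · rfl
      · exact h2 k hk
    rw [hx]
    refine (convex_convexHull ℝ _).sum_mem (fun i _ => h1 i) hA fun i hi => ?_
    exact subset_convexHull ℝ _ ⟨i, hi, rfl⟩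

theorem single_mem_simplexFace {A : Finset (Fin d)} {i : Fin d} (hi : i ∈ A) :
    (Pi.single i (1 : ℝ) : Fin d → ℝ) ∈ simplexFace A :=
  subset_convexHull ℝ _ ⟨i, hi, rfl⟩

theorem simplexFace_mono {A B : Finset (Fin d)} (h : A ⊆ B) :
    simplexFace A ⊆ simplexFace B :=
  convexHull_mono (Set.image_mono (by exact_mod_cast h))

theorem simplexFace_univ : simplexFace (Finset.univ : Finset (Fin d)) = stdSimplex ℝ (Fin d) := by
  ext x
  rw [mem_simplexFace]
  simp [stdSimplex]

theorem le_one_of_mem_simplexFace {A : Finset (Fin d)} {x : Fin d → ℝ} (hx : x ∈ simplexFace A)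
    (i : Fin d) : x i ≤ 1 := by
  rw [mem_simplexFace] at hx
  rw [← hx.2.2]
  exact Finset.single_le_sum (fun j _ => hx.1 j) (Finset.mem_univ i)

/-- The decompositions of a point of the Minkowski sum of the faces spanned by the `A j`. -/
def IsDecomp (A : Fin n → Finset (Fin d)) (x : Fin d → ℝ) (p : Fin n → Fin d → ℝ) : Prop :=
  (∀ j, p j ∈ simplexFace (A j)) ∧ ∑ j, p j = x

theorem mem_sum_simplexFace {A : Fin n → Finset (Fin d)} {x : Fin d → ℝ} :
    x ∈ ∑ j, simplexFace (A j) ↔ ∃ p, IsDecomp A x p := by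
  rw [Set.mem_fintype_sum]
  simp [IsDecomp]

/-- The independence of the affine hulls of the faces spanned by the `A j`, in coordinates. -/
def IndepFaces (A : Fin n → Finset (Fin d)) : Prop :=
  ∀ D : Fin n → Fin d → ℝ, (∀ j, ∀ i ∉ A j, D j i = 0) → (∀ j, ∑ i, D j i = 0) →
    ∑ j, D j = 0 → ∀ j, D j = 0

theorem mem_vectorSpan_simplexFace {A : Finset (Fin d)} (hA : A.Nonempty) {x : Fin d → ℝ}
    (h : ∀ i ∉ A, x i = 0) (hs : ∑ i, x i = 0) : x ∈ vectorSpan ℝ (simplexFace A) := by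
  obtain ⟨a, ha⟩ := hA
  have hA : ∑ i ∈ A, x i = 0 := by
    rw [← hs]; exact Finset.sum_subset (Finset.subset_univ _) fun i _ hi => h i hi
  have hx : x = ∑ i ∈ A, x i • ((Pi.single i (1 : ℝ) : Fin d → ℝ) -ᵥ Pi.single a 1) := by
    simp only [vsub_eq_sub, smul_sub, Finset.sum_sub_distrib, ← Finset.sum_smul, hA, zero_smul,
      sub_zero]
    funext k
    simp only [Finset.sum_apply, Pi.smul_apply, smul_eq_mul, Pi.single_apply, mul_ite, mul_one,
      mul_zero, Finset.sum_ite_eq]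
    split_ifs with hk
    · rfl
    · exact h k hk
  rw [hx]
  exact Submodule.sum_mem _ fun i hi => Submodule.smul_mem _ _
    (vsub_mem_vectorSpan ℝ (single_mem_simplexFace hi) (single_mem_simplexFace ha))

theorem indepFaces_of_iSupIndep {A : Fin n → Finset (Fin d)} (hA : ∀ j, (A j).Nonempty)
    (h : iSupIndep (fun j => vectorSpan ℝ (simplexFace (A j)))) : IndepFaces A := by
  rw [iSupIndep_iff_finsetSum_eq_zero_imp_eq_zero] at h
  intro D h1 h2 h3 j
  exact h Finset.univ D (fun j _ => mem_vectorSpan_simplexFace (hA j) (h1 j) (h2 j)) h3 j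
    (Finset.mem_univ j)

/-- In an independent Minkowski sum, moving along the direction of one summand only changes
the component of that summand. -/
theorem IndepFaces.decomp_add {A : Fin n → Finset (Fin d)} (hA : IndepFaces A)
    {x y w : Fin d → ℝ} {p r : Fin n → Fin d → ℝ} (hp : IsDecomp A x p) (hr : IsDecomp A y r)
    (j₀ : Fin n) (hw : ∀ i ∉ A j₀, w i = 0) (hw0 : ∑ i, w i = 0) (hy : y = x + w) :
    r j₀ = p j₀ + w ∧ ∀ j ≠ j₀, r j = p j := by
  -- These corrected differences lie in the directions of the summands and add up to zero.
  have key := hA (fun j => r j - p j - if j = j₀ then w else 0) ?_ ?_ ?_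
  · refine ⟨?_, fun j hj => ?_⟩
    · have := key j₀
      simp only [if_true] at this
      rw [sub_sub, sub_eq_zero] at this
      exact this
    · have := key j
      simp only [hj, if_false, sub_zero] at this
      exact sub_eq_zero.1 this
  · intro j i hi
    have h1 := (mem_simplexFace.1 (hp.1 j)).2.1 i hi
    have h2 := (mem_simplexFace.1 (hr.1 j)).2.1 i hi
    by_cases hj : j = j₀
    · subst hj; simp [h1, h2, hw i hi]
    · simp [hj, h1, h2]
  · intro j
    have h1 := (mem_simplexFace.1 (hp.1 j)).2.2
    have h2 := (mem_simplexFace.1 (hr.1 j)).2.2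
    by_cases hj : j = j₀
    · subst hj; simp [h1, h2, hw0]
    · simp [hj, h1, h2]
  · simp [Finset.sum_sub_distrib, hp.2, hr.2, hy]

theorem IndepFaces.decomp_unique {A : Fin n → Finset (Fin d)} (hA : IndepFaces A)
    {x : Fin d → ℝ} {p r : Fin n → Fin d → ℝ} (hp : IsDecomp A x p) (hr : IsDecomp A x r) :
    p = r := by
  funext j
  obtain ⟨h, -⟩ := hA.decomp_add hr hp j (w := 0) (by simp) (by simp) (by simp)
  simpa using h

/-- Otherwise `e_a - e_b` would be a common direction of two independent summands. -/
theorem IndepFaces.eq_of_mem {A : Fin n → Finset (Fin d)} (hA : IndepFaces A) {j k : Fin n}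
    {a b : Fin d} (hab : a ≠ b) (haj : a ∈ A j) (hbj : b ∈ A j) (hak : a ∈ A k) (hbk : b ∈ A k) :
    j = k := by
  by_contra hjk
  have key := hA (fun l => (if l = j then Pi.single a 1 - Pi.single b 1 else 0) -
    (if l = k then Pi.single a 1 - Pi.single b 1 else 0)) ?_ ?_ ?_ j
  · simp only [if_true, hjk, if_false, sub_zero] at key
    have := congrFun key a
    simp [hab] at this
  · intro l i hi
    have h : ∀ m : Fin n, a ∈ A m → b ∈ A m → l = m →
        (Pi.single a (1 : ℝ) - Pi.single b 1 : Fin d → ℝ) i = 0 := by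
      rintro m ha hb rfl
      have h1 : i ≠ a := by rintro rfl; exact hi ha
      have h2 : i ≠ b := by rintro rfl; exact hi hb
      simp [h1, h2]
    have e1 : (if l = j then (Pi.single a (1 : ℝ) - Pi.single b 1 : Fin d → ℝ) else 0) i = 0 := by
      split_ifs with hl
      · exact h j haj hbj hl
      · rfl
    have e2 : (if l = k then (Pi.single a (1 : ℝ) - Pi.single b 1 : Fin d → ℝ) else 0) i = 0 := by
      split_ifs with hl
      · exact h k hak hbk hl
      · rfl
    rw [Pi.sub_apply, e1, e2, sub_zero]
  · intro l
    split_ifs <;> simp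
  · simp [Finset.sum_sub_distrib]

theorem mem_dilatedSimplex (hn : 1 ≤ n) {x : Fin d → ℝ} (h : ∀ i, 0 ≤ x i)
    (hs : ∑ i, x i = n) : x ∈ dilatedSimplex n d := by
  have hn' : (n : ℝ) ≠ 0 := by positivity
  rw [dilatedSimplex, Set.mem_fintype_sum]
  refine ⟨fun _ => (n : ℝ)⁻¹ • x, fun _ => ⟨fun i => ?_, ?_⟩, ?_⟩
  · have := h i
    simp only [Pi.smul_apply, smul_eq_mul]; positivity
  · simp [← Finset.mul_sum, hs, hn']
  · simp [← Nat.cast_smul_eq_nsmul ℝ, smul_smul, hn']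

theorem isClosed_sum_simplexFace (A : Fin n → Finset (Fin d)) :
    IsClosed (∑ j, simplexFace (A j)) := by
  have h1 : (∑ j, simplexFace (A j)) =
      (fun p : Fin n → Fin d → ℝ => ∑ j, p j) '' Set.univ.pi fun j => simplexFace (A j) := by
    ext x
    rw [mem_sum_simplexFace]
    simp [IsDecomp, Set.mem_pi]
  rw [h1]
  refine ((isCompact_univ_pi fun j => ?_).image (by fun_prop)).isClosed
  exact ((A j).finite_toSet.image _).isCompact_convexHull ℝ

theorem IsFineMixedSubdivision.finite {S : Set (Set (Fin d → ℝ))}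
    (hS : IsFineMixedSubdivision n d S) : S.Finite := by
  refine (Set.finite_range fun A : Fin n → Finset (Fin d) => ∑ j, simplexFace (A j)).subset ?_
  intro C hC
  obtain ⟨A, -, -, -, rfl⟩ := hS.cell C hC
  exact ⟨A, rfl⟩

/-- A nonempty initial segment of a ray in the dilated simplex has a tile in common with its
starting point. -/
theorem IsFineMixedSubdivision.exists_tile_of_ray {S : Set (Set (Fin d → ℝ))}
    (hS : IsFineMixedSubdivision n d S) {q w : Fin d → ℝ} {ε : ℝ} (hε : 0 < ε)
    (h : ∀ t, 0 < t → t < ε → q + t • w ∈ dilatedSimplex n d) :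
    ∃ C ∈ S, q ∈ C ∧ ∃ t : ℝ, 0 < t ∧ q + t • w ∈ C := by
  -- Finitely many tiles cover the start of the ray, so one of them is met at arbitrarily small `t`;
  -- being closed, it contains `q`.
  have hex : ∃ C ∈ S, ∃ᶠ t in nhdsWithin (0 : ℝ) (Set.Ioi 0), q + t • w ∈ C := by
    by_contra! hno
    have h1 := (Filter.eventually_all_finite hS.finite).2 hno
    have h2 : ∀ᶠ t in nhdsWithin (0 : ℝ) (Set.Ioi 0), t ∈ Set.Ioo (0 : ℝ) ε :=
      Ioo_mem_nhdsGT hε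
    obtain ⟨t, ht1, ht2⟩ := (h1.and h2).exists
    have h3 := h t ht2.1 ht2.2
    rw [← hS.cover] at h3
    obtain ⟨C, hC, htC⟩ := h3
    exact ht1 C hC htC
  obtain ⟨C, hC, hfr⟩ := hex
  refine ⟨C, hC, ?_, ?_⟩
  · obtain ⟨A, -, -, -, rfl⟩ := hS.cell C hC
    refine (isClosed_sum_simplexFace A).mem_of_frequently_of_tendsto hfr ?_
    have : Filter.Tendsto (fun t : ℝ => q + t • w) (nhds 0) (nhds (q + (0 : ℝ) • w)) :=
      Continuous.tendsto (by fun_prop) 0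
    rw [zero_smul, add_zero] at this
    exact this.mono_left nhdsWithin_le_nhds
  · obtain ⟨t, h1, h2⟩ := (hfr.and_eventually self_mem_nhdsWithin).exists
    exact ⟨t, h2, h1⟩

/-- A tile of the subdivision, given by the faces of which it is the Minkowski sum. -/
def IsTile (S : Set (Set (Fin d → ℝ))) (A : Fin n → Finset (Fin d)) : Prop :=
  IndepFaces A ∧ ∑ j, simplexFace (A j) ∈ S

theorem IsFineMixedSubdivision.exists_isTile {S : Set (Set (Fin d → ℝ))}
    (hS : IsFineMixedSubdivision n d S) {C : Set (Fin d → ℝ)} (hC : C ∈ S) :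
    ∃ A : Fin n → Finset (Fin d), IsTile S A ∧ C = ∑ j, simplexFace (A j) := by
  obtain ⟨A, h1, h2, -, rfl⟩ := hS.cell C hC
  exact ⟨A, ⟨indepFaces_of_iSupIndep h1 h2, hC⟩, rfl⟩

/-- A point lies in an open segment whose ends are a point with smaller support in each component
and another point of the tile. -/
theorem exists_mem_openSegment {A : Fin n → Finset (Fin d)} {x y : Fin d → ℝ}
    {p r : Fin n → Fin d → ℝ} (hp : IsDecomp A x p) (hr : IsDecomp A y r)
    (hsupp : ∀ j i, r j i ≠ 0 → p j i ≠ 0) :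
    ∃ z ∈ ∑ j, simplexFace (A j), x ∈ openSegment ℝ y z := by
  -- Since `r` vanishes wherever `p` does, a small multiple of `r` can be subtracted from `p`;
  -- rescaling by `(1 - ε)⁻¹` gives the far end.
  have hεex : ∃ ε : ℝ, 0 < ε ∧ ε < 1 ∧ ∀ j i, ε * r j i ≤ p j i := by
    have h1 : ∀ j i, ∀ᶠ ε in nhdsWithin (0 : ℝ) (Set.Ioi 0), ε * r j i ≤ p j i := by
      intro j i
      by_cases h : r j i = 0
      · simp [h, (mem_simplexFace.1 (hp.1 j)).1 i]
      · have hpos : 0 < p j i :=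
          lt_of_le_of_ne ((mem_simplexFace.1 (hp.1 j)).1 i) (hsupp j i h).symm
        have : Filter.Tendsto (fun ε : ℝ => ε * r j i) (nhds 0) (nhds (0 * r j i)) :=
          Continuous.tendsto (by fun_prop) 0
        rw [zero_mul] at this
        exact ((this.mono_left nhdsWithin_le_nhds).eventually_lt_const hpos).mono fun _ h => h.le
    have h2 : ∀ᶠ ε in nhdsWithin (0 : ℝ) (Set.Ioi 0), ε ∈ Set.Ioo (0 : ℝ) 1 :=
      Ioo_mem_nhdsGT one_pos
    obtain ⟨ε, e1, e2⟩ := (h2.and (Filter.eventually_all.2 fun j =>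
      Filter.eventually_all.2 fun i => h1 j i)).exists
    exact ⟨ε, e1.1, e1.2, e2⟩
  obtain ⟨ε, h0, h1, hle⟩ := hεex
  have h1' : 0 < 1 - ε := sub_pos.2 h1
  refine ⟨∑ j, (1 - ε)⁻¹ • (p j - ε • r j), mem_sum_simplexFace.2 ⟨_, fun j => ?_, rfl⟩,
    ε, 1 - ε, h0, h1', by ring, ?_⟩
  · have hpj := mem_simplexFace.1 (hp.1 j)
    have hrj := mem_simplexFace.1 (hr.1 j)
    refine mem_simplexFace.2 ⟨fun i => ?_, fun i hi => ?_, ?_⟩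
    · have := hle j i
      simp only [Pi.smul_apply, Pi.sub_apply, smul_eq_mul]
      exact mul_nonneg (inv_nonneg.2 h1'.le) (sub_nonneg.2 this)
    · simp [hpj.2.1 i hi, hrj.2.1 i hi]
    · simp only [Pi.smul_apply, Pi.sub_apply, smul_eq_mul, ← Finset.mul_sum,
        Finset.sum_sub_distrib, hpj.2.2, hrj.2.2, mul_one]
      exact inv_mul_cancel₀ h1'.ne'
  · rw [← Finset.smul_sum, smul_smul, mul_inv_cancel₀ h1'.ne', one_smul,
      Finset.sum_sub_distrib, ← Finset.smul_sum, hp.2, hr.2]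
    abel

/-- Minimal faces of a common point in two tiles agree: a point of the minimal face in the first
tile lies in the second tile, in the minimal face there. -/
theorem IsFineMixedSubdivision.exists_decomp {S : Set (Set (Fin d → ℝ))}
    (hS : IsFineMixedSubdivision n d S) {A A' : Fin n → Finset (Fin d)} (hA : IsTile S A)
    (hA' : IsTile S A') {x y : Fin d → ℝ} {p r p' : Fin n → Fin d → ℝ} (hp : IsDecomp A x p)
    (hr : IsDecomp A y r) (hp' : IsDecomp A' x p') (hsupp : ∀ j i, r j i ≠ 0 → p j i ≠ 0) :
    ∃ r', IsDecomp A' y r' ∧ ∀ j i, r' j i ≠ 0 → p' j i ≠ 0 := by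
  obtain ⟨z, hz, hxyz⟩ := exists_mem_openSegment hp hr hsupp
  -- The intersection is a face of the first tile, so both ends of a segment of that tile through
  -- `x` lie in the second tile.
  have hext := (hS.face _ hA.2 _ hA'.2).1.isExtreme
  have hy : y ∈ ∑ j, simplexFace (A j) := mem_sum_simplexFace.2 ⟨r, hr⟩
  have hx : x ∈ (∑ j, simplexFace (A j)) ∩ ∑ j, simplexFace (A' j) :=
    ⟨mem_sum_simplexFace.2 ⟨p, hp⟩, mem_sum_simplexFace.2 ⟨p', hp'⟩⟩
  have hy' := (hext.left_mem_of_mem_openSegment hy hz hx hxyz).2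
  have hz' := (hext.left_mem_of_mem_openSegment hz hy hx
    (by rw [openSegment_symm]; exact hxyz)).2
  obtain ⟨r', hr'⟩ := mem_sum_simplexFace.1 hy'
  obtain ⟨s', hs'⟩ := mem_sum_simplexFace.1 hz'
  refine ⟨r', hr', fun j i hji => ?_⟩
  obtain ⟨a, b, ha, hb, hab, hx'⟩ := hxyz
  -- By uniqueness this is `p'`, and nonnegative terms cannot cancel, so `r'` has its support inside
  -- that of `p'`.
  have hdec : IsDecomp A' x fun j => a • r' j + b • s' j := by
    refine ⟨fun j => convex_convexHull ℝ _ (hr'.1 j) (hs'.1 j) ha.le hb.le hab, ?_⟩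
    rw [Finset.sum_add_distrib, ← Finset.smul_sum, ← Finset.smul_sum, hr'.2, hs'.2, hx']
  rw [hA'.1.decomp_unique hp' hdec]
  have h1 : 0 < r' j i := lt_of_le_of_ne ((mem_simplexFace.1 (hr'.1 j)).1 i) hji.symm
  have h2 : 0 ≤ s' j i := (mem_simplexFace.1 (hs'.1 j)).1 i
  simp only [Pi.add_apply, Pi.smul_apply, smul_eq_mul]
  positivity

end Basics

/-! ### Translated simplex faces and their transfer between tiles -/

section Faces

variable {n d : ℕ}

/-- A lattice point as a point of `ℝ^d`. -/
def toRealVec (u : Fin d → ℕ) : Fin d → ℝ := fun i => (u i : ℝ)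

theorem toRealVec_injective : Function.Injective (toRealVec (d := d)) := fun _ _ h =>
  funext fun i => Nat.cast_injective (R := ℝ) (congrFun h i)

theorem toRealVec_add (u v : Fin d → ℕ) : toRealVec (u + v) = toRealVec u + toRealVec v := by
  funext i; simp [toRealVec]

theorem toRealVec_single (i : Fin d) : toRealVec (Pi.single i 1) = Pi.single i 1 := by
  funext k
  by_cases h : k = i
  · subst h; simp [toRealVec]
  · simp [toRealVec, h]

theorem toRealVec_sum {ι : Type*} (s : Finset ι) (u : ι → Fin d → ℕ) :
    toRealVec (∑ j ∈ s, u j) = ∑ j ∈ s, toRealVec (u j) := by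
  funext k; simp [toRealVec]

theorem toRealVec_nonneg (u : Fin d → ℕ) (i : Fin d) : 0 ≤ toRealVec u i := Nat.cast_nonneg _

theorem single_injective {R : Type*} [NonAssocSemiring R] [Nontrivial R] {a b : Fin d}
    (h : (Pi.single a (1 : R) : Fin d → R) = Pi.single b 1) : a = b := by
  by_contra hab
  simpa [hab] using congrFun h a

theorem eq_single_of_support {A : Finset (Fin d)} {x : Fin d → ℝ} {a : Fin d}
    (hx : x ∈ simplexFace A) (h : ∀ i, x i ≠ 0 → i = a) : x = Pi.single a 1 := by
  have h0 : ∀ i, i ≠ a → x i = 0 := fun i hi => by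
    by_contra h'; exact hi (h i h')
  have h1 : x a = 1 := by
    rw [← (mem_simplexFace.1 hx).2.2]
    exact (Finset.sum_eq_single a (fun i _ hi => h0 i hi) (by simp)).symm
  funext i
  by_cases hi : i = a
  · subst hi; simp [h1]
  · simp [hi, h0 i hi]

theorem eq_single_of_one_le {A : Finset (Fin d)} {x : Fin d → ℝ} {a : Fin d}
    (hx : x ∈ simplexFace A) (h : 1 ≤ x a) : x = Pi.single a 1 := by
  refine eq_single_of_support hx fun i hi => ?_
  by_contra hia
  rw [mem_simplexFace] at hx
  have h1 : x i + x a ≤ 1 := by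
    rw [← hx.2.2, ← Finset.sum_pair hia]
    exact Finset.sum_le_sum_of_subset_of_nonneg (Finset.subset_univ _) fun j _ _ => hx.1 j
  have h2 : 0 < x i := lt_of_le_of_ne (hx.1 i) (Ne.symm hi)
  linarith

theorem exists_ne_zero_of_mem_simplexFace {A : Finset (Fin d)} {x : Fin d → ℝ}
    (hx : x ∈ simplexFace A) : ∃ i, x i ≠ 0 := by
  by_contra! h
  have := (mem_simplexFace.1 hx).2.2
  simp [h] at this

/-- Free of subtraction, so that the same exchange serves lattice vectors and real points. -/
theorem sum_single_update {ι R : Type*} [DecidableEq ι] [AddCommMonoid R] [One R]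
    {s : Finset ι} (g : ι → Fin d) {k : ι} (hk : k ∈ s) (a : Fin d) :
    ∑ j ∈ s, (Pi.single (Function.update g k a j) 1 : Fin d → R) + Pi.single (g k) 1 =
      ∑ j ∈ s, Pi.single (g j) 1 + Pi.single a 1 := by
  rw [← Finset.add_sum_erase _ _ hk,
    ← Finset.add_sum_erase s (fun j => (Pi.single (g j) 1 : Fin d → R)) hk,
    Function.update_self,
    Finset.sum_congr rfl fun j hj => by rw [Function.update_of_ne (Finset.ne_of_mem_erase hj)]]
  abel

/-- The translate by `u` of the face spanned by `B` is a face of the Minkowski sum of the faces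
spanned by the `A j`, coming from `B ⊆ A j₀` and the vertices `f j ∈ A j` for `j ≠ j₀`. -/
def FaceAt (A : Fin n → Finset (Fin d)) (B : Finset (Fin d)) (u : Fin d → ℕ) (j₀ : Fin n)
    (f : Fin n → Fin d) : Prop :=
  B ⊆ A j₀ ∧ (∀ j ≠ j₀, f j ∈ A j) ∧ u = ∑ j ∈ Finset.univ.erase j₀, Pi.single (f j) 1

/-- The family of the vertices `f j` for `j ≠ j₀`, together with `y` at `j₀`. -/
def vertDecomp (j₀ : Fin n) (f : Fin n → Fin d) (y : Fin d → ℝ) : Fin n → Fin d → ℝ :=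
  Function.update (fun j => Pi.single (f j) 1) j₀ y

@[simp] theorem vertDecomp_self (j₀ : Fin n) (f : Fin n → Fin d) (y : Fin d → ℝ) :
    vertDecomp j₀ f y j₀ = y := Function.update_self ..

theorem vertDecomp_of_ne {j₀ j : Fin n} (hj : j ≠ j₀) (f : Fin n → Fin d) (y : Fin d → ℝ) :
    vertDecomp j₀ f y j = Pi.single (f j) 1 := Function.update_of_ne hj ..

theorem FaceAt.isDecomp {A : Fin n → Finset (Fin d)} {B : Finset (Fin d)} {u : Fin d → ℕ}
    {j₀ : Fin n} {f : Fin n → Fin d} (h : FaceAt A B u j₀ f) {y : Fin d → ℝ}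
    (hy : y ∈ simplexFace (A j₀)) : IsDecomp A (toRealVec u + y) (vertDecomp j₀ f y) := by
  refine ⟨fun j => ?_, ?_⟩
  · by_cases hj : j = j₀
    · subst hj; simpa using hy
    · rw [vertDecomp_of_ne hj]; exact single_mem_simplexFace (h.2.1 j hj)
  · rw [← Finset.add_sum_erase _ _ (Finset.mem_univ j₀), vertDecomp_self,
      Finset.sum_congr rfl fun j hj => vertDecomp_of_ne (Finset.ne_of_mem_erase hj) f y,
      h.2.2, toRealVec_sum, add_comm]
    simp only [toRealVec_single]

theorem FaceAt.sum_add_one {A : Fin n → Finset (Fin d)} {B : Finset (Fin d)} {u : Fin d → ℕ}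
    {j₀ : Fin n} {f : Fin n → Fin d} (h : FaceAt A B u j₀ f) : ∑ i, u i + 1 = n := by
  rw [h.2.2]
  simp only [Finset.sum_apply]
  rw [Finset.sum_comm]
  have := j₀.pos
  simp
  omega

/-- A face spanned by at least two vertices that contains in its relative interior a point of
another tile is also a face of that tile. -/
theorem IsFineMixedSubdivision.faceAt_transfer {S : Set (Set (Fin d → ℝ))}
    (hS : IsFineMixedSubdivision n d S) {A A' : Fin n → Finset (Fin d)} (hA : IsTile S A)
    (hA' : IsTile S A') {B : Finset (Fin d)} (hB : B.Nontrivial) {u : Fin d → ℕ}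
    {j₀ : Fin n} {f : Fin n → Fin d} (h : FaceAt A B u j₀ f) {y : Fin d → ℝ}
    (hy : y ∈ simplexFace B) (hyB : ∀ i ∈ B, y i ≠ 0)
    (hmem : toRealVec u + y ∈ ∑ j, simplexFace (A' j)) : ∃ j₁ f', FaceAt A' B u j₁ f' := by
  obtain ⟨p, hp⟩ := mem_sum_simplexFace.1 hmem
  have hq := h.isDecomp (simplexFace_mono h.1 hy)
  have hmemA : ∀ j i, p j i ≠ 0 → i ∈ A' j := fun j i hi => by
    by_contra hiA; exact hi ((mem_simplexFace.1 (hp.1 j)).2.1 i hiA)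
  -- every vertex of the minimal face in `A'` is a vertex of the given face
  have hvert : ∀ g : Fin n → Fin d, (∀ j, p j (g j) ≠ 0) →
      ∃ b ∈ B, ∑ j, (Pi.single (g j) 1 : Fin d → ℝ) = toRealVec u + Pi.single b 1 := by
    intro g hg
    have hg' : IsDecomp A' (∑ j, (Pi.single (g j) 1 : Fin d → ℝ)) fun j => Pi.single (g j) 1 :=
      ⟨fun j => single_mem_simplexFace (hmemA j _ (hg j)), rfl⟩
    obtain ⟨r, hr, hrs⟩ := hS.exists_decomp hA' hA hp hg' hq (fun j i hi => by
      have : i = g j := by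
        by_contra hne; simp [hne] at hi
      rw [this]; exact hg j)
    have hr' : ∀ j ≠ j₀, r j = Pi.single (f j) 1 := fun j hj => by
      refine eq_single_of_support (hr.1 j) fun i hi => ?_
      have := hrs j i hi
      rw [vertDecomp_of_ne hj] at this
      by_contra hne; simp [hne] at this
    have hsum : ∑ j, (Pi.single (g j) 1 : Fin d → ℝ) = toRealVec u + r j₀ := by
      rw [← hr.2, ← (h.isDecomp (hr.1 j₀)).2]
      refine Finset.sum_congr rfl fun j _ => ?_
      by_cases hj : j = j₀
      · subst hj; simp
      · rw [hr' j hj, vertDecomp_of_ne hj]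
    obtain ⟨b, hb⟩ := exists_ne_zero_of_mem_simplexFace (hr.1 j₀)
    have hbB : b ∈ B := by
      have := hrs j₀ b hb
      rw [vertDecomp_self] at this
      by_contra hne; exact this ((mem_simplexFace.1 hy).2.1 b hne)
    refine ⟨b, hbB, ?_⟩
    -- `r j₀` is a difference of lattice points, so its positive coordinate at `b` is at least `1`.
    rw [hsum, eq_single_of_one_le (hr.1 j₀) (a := b)]
    have hpos : 0 < r j₀ b := lt_of_le_of_ne ((mem_simplexFace.1 (hr.1 j₀)).1 b) hb.symm
    have hint : toRealVec (∑ j, Pi.single (g j) 1) b = toRealVec u b + r j₀ b := by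
      rw [toRealVec_sum]
      simp only [toRealVec_single]
      exact congrFun hsum b
    have hlt : u b < (∑ j, (Pi.single (g j) 1 : Fin d → ℕ)) b := by
      have : toRealVec u b < toRealVec (∑ j, Pi.single (g j) 1) b := by linarith
      exact Nat.cast_lt.1 this
    have hlt' : toRealVec u b + 1 ≤ toRealVec (∑ j, Pi.single (g j) 1) b := by
      simp only [toRealVec]; exact_mod_cast hlt
    linarith
  have hne : ∀ j, ∃ i, p j i ≠ 0 := fun j => exists_ne_zero_of_mem_simplexFace (hp.1 j)
  choose g hg using hne
  -- If every component were a vertex, the point would be some `u + e_b`, although `y` is nonzero on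
  -- all of `B`.
  have hj₁ : ∃ j₁, ∀ i, ∃ i', p j₁ i' ≠ 0 ∧ i' ≠ i := by
    by_contra! hno
    choose i hi using hno
    have hpg : ∀ j, p j = Pi.single (i j) 1 := fun j => eq_single_of_support (hp.1 j) (hi j)
    have hgi : ∀ j, p j (i j) ≠ 0 := fun j => by rw [hpg j]; simp
    obtain ⟨b, -, hbs⟩ := hvert i hgi
    have h1 : toRealVec u + y = toRealVec u + Pi.single b 1 := by
      rw [← hp.2, ← hbs]; exact Finset.sum_congr rfl fun j _ => hpg j
    obtain ⟨b', hb'B, hb'⟩ := hB.exists_ne b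
    refine hyB b' hb'B ?_
    rw [add_left_cancel h1]; simp [hb']
  obtain ⟨j₁, hj₁⟩ := hj₁
  -- Replacing the entry `g j₁` by another `a` lowers the coordinate at `g j₁` by one. Both sums
  -- have the form `u + e_b`, so the original `b` is `g j₁`.
  have hval : ∀ g : Fin n → Fin d, (∀ j, p j (g j) ≠ 0) →
      ∑ j, (Pi.single (g j) 1 : Fin d → ℝ) = toRealVec u + Pi.single (g j₁) 1 := by
    intro g hg
    obtain ⟨a, ha, hag⟩ := hj₁ (g j₁)
    have hga : ∀ j, p j (Function.update g j₁ a j) ≠ 0 := fun j => by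
      by_cases hj : j = j₁
      · subst hj; simpa using ha
      · rw [Function.update_of_ne hj]; exact hg j
    obtain ⟨b, -, hb⟩ := hvert g hg
    obtain ⟨b', -, hb'⟩ := hvert _ hga
    have hupd := sum_single_update (R := ℝ) g (Finset.mem_univ j₁) a
    rw [hb, hb'] at hupd
    have : b = g j₁ := by
      by_contra hbg
      have := congrFun hupd (g j₁)
      have h0 : (0 : ℝ) ≤ (Pi.single b' (1 : ℝ) : Fin d → ℝ) (g j₁) :=
        (Pi.single_nonneg.2 zero_le_one : (0 : Fin d → ℝ) ≤ Pi.single b' 1) _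
      simp only [Pi.add_apply, Pi.single_eq_same, Pi.single_eq_of_ne hag.symm,
        Pi.single_eq_of_ne (Ne.symm hbg)] at this
      linarith
    rw [hb, this]
  -- By `hval` the choice at `j ≠ j₁` does not affect the sum, so only one choice exists.
  have hp1 : ∀ j ≠ j₁, p j = Pi.single (g j) 1 := by
    intro j hj
    refine eq_single_of_support (hp.1 j) fun i hi => ?_
    have hgi : ∀ k, p k (Function.update g j i k) ≠ 0 := fun k => by
      by_cases hk : k = j
      · subst hk; simpa using hi
      · rw [Function.update_of_ne hk]; exact hg k
    have h1 := hval _ hgi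
    rw [Function.update_of_ne hj.symm, ← hval g hg] at h1
    have hupd := sum_single_update (R := ℝ) g (Finset.mem_univ j) i
    rw [h1] at hupd
    exact (single_injective (add_left_cancel hupd)).symm
  have hu : u = ∑ j ∈ Finset.univ.erase j₁, Pi.single (g j) 1 := by
    apply toRealVec_injective
    rw [toRealVec_sum]
    simp only [toRealVec_single]
    have := hval g hg
    rw [← Finset.add_sum_erase _ _ (Finset.mem_univ j₁), add_comm] at this
    exact (add_right_cancel this).symm
  refine ⟨j₁, g, fun i hi => ?_, fun j _ => hmemA j _ (hg j), hu⟩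
  have hpy : p j₁ = y := by
    have h1 := hp.2
    rw [← Finset.add_sum_erase _ _ (Finset.mem_univ j₁), Finset.sum_congr rfl
      fun j hj => hp1 j (Finset.ne_of_mem_erase hj), add_comm, hu, toRealVec_sum] at h1
    simp only [toRealVec_single] at h1
    exact add_left_cancel h1
  exact hmemA j₁ i (by rw [hpy]; exact hyB i hi)

end Faces

/-! ### Links between parallel faces of one tile -/

section Links

variable {n d : ℕ}

/-- The translate by `u` of the face spanned by `B` is a face of some tile. -/
def HasFace (n : ℕ) (S : Set (Set (Fin d → ℝ))) (B : Finset (Fin d)) (u : Fin d → ℕ) : Prop :=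
  ∃ (A : Fin n → Finset (Fin d)) (j₀ : Fin n) (f : Fin n → Fin d), IsTile S A ∧ FaceAt A B u j₀ f

/-- The translates by `u'` and `u = u' + e_c - e_x` of the face spanned by `B` are faces of the
same tile, parallel along the same summand. -/
def FaceLink (n : ℕ) (S : Set (Set (Fin d → ℝ))) (B : Finset (Fin d)) (c : Fin d)
    (u' u : Fin d → ℕ) (x : Fin d) : Prop :=
  ∃ (A : Fin n → Finset (Fin d)) (j₀ : Fin n) (f' f : Fin n → Fin d), IsTile S A ∧
    FaceAt A B u' j₀ f' ∧ FaceAt A B u j₀ f ∧ x ∈ B ∧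
      u + Pi.single x 1 = u' + Pi.single c 1

theorem HasFace.sum_add_one {S : Set (Set (Fin d → ℝ))} {B : Finset (Fin d)} {u : Fin d → ℕ}
    (h : HasFace n S B u) : ∑ i, u i + 1 = n := by
  obtain ⟨A, j₀, f, -, h⟩ := h
  exact h.sum_add_one

theorem HasFace.mono {S : Set (Set (Fin d → ℝ))} {B B' : Finset (Fin d)} {u : Fin d → ℕ}
    (h : HasFace n S B u) (hB : B' ⊆ B) : HasFace n S B' u := by
  obtain ⟨A, j₀, f, hA, h1, h2⟩ := h
  exact ⟨A, j₀, f, hA, hB.trans h1, h2⟩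

theorem FaceLink.lower {S : Set (Set (Fin d → ℝ))} {B : Finset (Fin d)} {c x : Fin d}
    {u' u : Fin d → ℕ} (h : FaceLink n S B c u' u x) : HasFace n S B u' := by
  obtain ⟨A, j₀, f', f, hA, h1, -⟩ := h
  exact ⟨A, j₀, f', hA, h1⟩

theorem FaceLink.upper {S : Set (Set (Fin d → ℝ))} {B : Finset (Fin d)} {c x : Fin d}
    {u' u : Fin d → ℕ} (h : FaceLink n S B c u' u x) : HasFace n S B u := by
  obtain ⟨A, j₀, f', f, hA, -, h1, -⟩ := h
  exact ⟨A, j₀, f, hA, h1⟩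

theorem FaceLink.add_single {S : Set (Set (Fin d → ℝ))} {B : Finset (Fin d)} {c x : Fin d}
    {u' u : Fin d → ℕ} (h : FaceLink n S B c u' u x) :
    u + Pi.single x 1 = u' + Pi.single c 1 := by
  obtain ⟨A, j₀, f', f, -, -, -, -, h⟩ := h
  exact h

theorem sum_single_eq_one {s : Finset (Fin d)} {c : Fin d} (hc : c ∈ s) :
    ∑ i ∈ s, (Pi.single c (1 : ℝ) : Fin d → ℝ) i = 1 := by
  simp [Pi.single_apply, hc]

/-- The barycenter of the face of the standard simplex spanned by `B`. -/
noncomputable def faceCenter (B : Finset (Fin d)) : Fin d → ℝ :=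
  fun i => if i ∈ B then (B.card : ℝ)⁻¹ else 0

theorem faceCenter_pos {B : Finset (Fin d)} {i : Fin d} (hi : i ∈ B) : 0 < faceCenter B i := by
  have : 0 < B.card := Finset.card_pos.2 ⟨i, hi⟩
  simp only [faceCenter, hi, if_true]
  positivity

theorem faceCenter_nonneg (B : Finset (Fin d)) (i : Fin d) : 0 ≤ faceCenter B i := by
  unfold faceCenter; split_ifs <;> positivity

theorem faceCenter_of_notMem {B : Finset (Fin d)} {i : Fin d} (hi : i ∉ B) :
    faceCenter B i = 0 := if_neg hi

theorem faceCenter_mem {B : Finset (Fin d)} (hB : B.Nonempty) :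
    faceCenter B ∈ simplexFace B := by
  refine mem_simplexFace.2 ⟨faceCenter_nonneg B, fun i hi => faceCenter_of_notMem hi, ?_⟩
  have : (B.card : ℝ) ≠ 0 := by exact_mod_cast hB.card_pos.ne'
  simp [faceCenter, this]

theorem sum_faceCenter {B : Finset (Fin d)} (hB : B.Nonempty) : ∑ i, faceCenter B i = 1 :=
  (mem_simplexFace.1 (faceCenter_mem hB)).2.2

/-- If a tile contains points beyond a face in the direction from `e_c` to the face, then mass
can be moved from `e_c` to a vertex of the face along the other summands. -/
theorem FaceAt.exists_lower {A : Fin n → Finset (Fin d)} {B : Finset (Fin d)} {u : Fin d → ℕ}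
    {j₀ : Fin n} {f : Fin n → Fin d} (h : FaceAt A B u j₀ f) (hB : B.Nonempty) {c : Fin d}
    {t : ℝ} (ht : 0 < t) {r : Fin n → Fin d → ℝ}
    (hr : IsDecomp A (toRealVec u + faceCenter B + t • (faceCenter B - Pi.single c 1)) r) :
    ∃ u' f', ∃ x ∈ B, FaceAt A B u' j₀ f' ∧ u + Pi.single x 1 = u' + Pi.single c 1 := by
  set β := faceCenter B with hβ
  have hp := h.isDecomp (simplexFace_mono h.1 (faceCenter_mem hB))
  -- Reachability as for augmenting paths: from each `y ∈ Z` one unit can be moved to a vertex of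
  -- `B`, changing only summands with `f j ∈ Z`. That restriction keeps a summand at `f j ∉ Z`
  -- available for the next extension.
  let good : Finset (Fin d) → Prop := fun Z => B ⊆ Z ∧ ∀ y ∈ Z, ∃ f' : Fin n → Fin d, ∃ x ∈ B,
    (∀ j ≠ j₀, f' j ∈ A j) ∧ (∀ j, f j ∉ Z → f' j = f j) ∧
    ∑ j ∈ Finset.univ.erase j₀, (Pi.single (f' j) 1 : Fin d → ℕ) + Pi.single y 1 =
      ∑ j ∈ Finset.univ.erase j₀, Pi.single (f j) 1 + Pi.single x 1
  have hgB : good B := ⟨subset_rfl, fun y hy => ⟨f, y, hy, h.2.1, fun _ _ => rfl, rfl⟩⟩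
  obtain ⟨Z, hZ⟩ := (Set.toFinite {Z | good Z}).exists_maximal ⟨B, hgB⟩
  obtain ⟨⟨hBZ, hZg⟩, hmax⟩ := hZ
  by_cases hcZ : c ∈ Z
  · obtain ⟨f', x, hx, h1, -, h2⟩ := hZg c hcZ
    refine ⟨_, f', x, hx, ⟨h.1, h1, rfl⟩, ?_⟩
    rw [h2, h.2.2]
  exfalso
  -- A cut argument: otherwise no component of `r` has less mass outside `Z` than the one it
  -- replaces, whereas the total mass there drops by `t`, because `B ⊆ Z` and `c ∉ Z`.
  have harc : ∃ j ≠ j₀, f j ∉ Z ∧ ∃ y ∈ Z, r j y ≠ 0 := by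
    by_contra! hno
    have h1 : ∀ j, 0 ≤ ∑ i ∈ Zᶜ, (r j i - vertDecomp j₀ f β j i) := by
      intro j
      have hrj := mem_simplexFace.1 (hr.1 j)
      by_cases hj : j = j₀
      · subst hj
        refine Finset.sum_nonneg fun i hi => ?_
        rw [vertDecomp_self, hβ, faceCenter_of_notMem fun hiB => (Finset.mem_compl.1 hi) (hBZ hiB),
          sub_zero]
        exact hrj.1 i
      by_cases hjZ : f j ∈ Z
      · refine Finset.sum_nonneg fun i hi => ?_
        have : i ≠ f j := by rintro rfl; exact (Finset.mem_compl.1 hi) hjZ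
        rw [vertDecomp_of_ne hj, Pi.single_eq_of_ne this, sub_zero]
        exact hrj.1 i
      · rw [Finset.sum_sub_distrib]
        have e1 : ∑ i ∈ Zᶜ, r j i = 1 := by
          rw [← hrj.2.2]
          refine Finset.sum_subset (Finset.subset_univ _) fun i _ hi => ?_
          exact hno j hj hjZ i (by simpa using hi)
        have e2 : ∑ i ∈ Zᶜ, vertDecomp j₀ f β j i = 1 := by
          rw [vertDecomp_of_ne hj]
          exact sum_single_eq_one (Finset.mem_compl.2 hjZ)
        rw [e1, e2, sub_self]
    have h2 : ∑ j, ∑ i ∈ Zᶜ, (r j i - vertDecomp j₀ f β j i) = -t := by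
      rw [Finset.sum_comm]
      have h3 : ∀ i, ∑ j, (r j i - vertDecomp j₀ f β j i) =
          t * (β i - (Pi.single c (1 : ℝ) : Fin d → ℝ) i) := by
        intro i
        have e1 := congrFun hr.2 i
        have e2 := congrFun hp.2 i
        simp only [Finset.sum_apply, Pi.add_apply, Pi.smul_apply, Pi.sub_apply,
          smul_eq_mul] at e1 e2
        rw [Finset.sum_sub_distrib, e1, e2]
        ring
      simp only [h3]
      rw [← Finset.mul_sum, Finset.sum_sub_distrib, sum_single_eq_one (Finset.mem_compl.2 hcZ),
        Finset.sum_eq_zero fun i hi => faceCenter_of_notMem fun hiB =>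
          (Finset.mem_compl.1 hi) (hBZ hiB)]
      ring
    have h3 := Finset.sum_nonneg fun j (_ : j ∈ Finset.univ) => h1 j
    linarith
  obtain ⟨j, hj, hjZ, y, hy, hry⟩ := harc
  obtain ⟨f₁, x, hx, h1, h2, h3⟩ := hZg y hy
  have hyA : y ∈ A j := by
    by_contra hyA; exact hry ((mem_simplexFace.1 (hr.1 j)).2.1 y hyA)
  have hgood : good (insert (f j) Z) := by
    refine ⟨hBZ.trans (Finset.subset_insert _ _), fun y' hy' => ?_⟩
    rw [Finset.mem_insert] at hy'
    rcases hy' with rfl | hy'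
    · refine ⟨Function.update f₁ j y, x, hx, fun k hk => ?_, fun k hk => ?_, ?_⟩
      · by_cases hkj : k = j
        · subst hkj; simpa using hyA
        · rw [Function.update_of_ne hkj]; exact h1 k hk
      · have hkj : k ≠ j := by rintro rfl; exact hk (Finset.mem_insert_self _ _)
        rw [Function.update_of_ne hkj]
        exact h2 k fun hkZ => hk (Finset.mem_insert_of_mem hkZ)
      · have := sum_single_update (R := ℕ) f₁ (Finset.mem_erase.2 ⟨hj, Finset.mem_univ j⟩) y
        rw [h2 j hjZ] at this
        rw [this, h3]
    · obtain ⟨f₂, x₂, hx₂, k1, k2, k3⟩ := hZg y' hy'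
      exact ⟨f₂, x₂, hx₂, k1, fun k hk => k2 k fun hkZ => hk (Finset.mem_insert_of_mem hkZ), k3⟩
  exact hjZ (hmax hgood (Finset.subset_insert _ _) (Finset.mem_insert_self _ _))

/-- Because `u c ≥ 1`, the barycenter of the face can be pushed away from `e_c` inside the dilated
simplex. A tile met by this ray has the same face, and `FaceAt.exists_lower` finds a parallel face
in it. -/
theorem IsFineMixedSubdivision.exists_lower {S : Set (Set (Fin d → ℝ))}
    (hS : IsFineMixedSubdivision n d S) {B : Finset (Fin d)} (hB : B.Nontrivial) {u : Fin d → ℕ}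
    (h : HasFace n S B u) {c : Fin d} (huc : 1 ≤ u c) :
    ∃ u' x, FaceLink n S B c u' u x := by
  have hsum := h.sum_add_one
  have hray := hS.exists_tile_of_ray (q := toRealVec u + faceCenter B)
    (w := faceCenter B - Pi.single c 1) one_pos fun t ht0 ht1 => by
      refine mem_dilatedSimplex (by omega) (fun i => ?_) ?_
      · have h1 := faceCenter_nonneg B i
        have h2 : t * (Pi.single c (1 : ℝ) : Fin d → ℝ) i ≤ toRealVec u i := by
          by_cases hi : i = c
          · subst hi
            have : (1 : ℝ) ≤ toRealVec u i := by simp only [toRealVec]; exact_mod_cast huc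
            rw [Pi.single_eq_same]; linarith
          · rw [Pi.single_eq_of_ne hi, mul_zero]; exact toRealVec_nonneg u i
        simp only [Pi.add_apply, Pi.smul_apply, Pi.sub_apply, smul_eq_mul, mul_sub]
        have := mul_nonneg ht0.le h1
        linarith
      · simp only [Pi.add_apply, Pi.smul_apply, Pi.sub_apply, smul_eq_mul, Finset.sum_add_distrib,
          ← Finset.mul_sum, Finset.sum_sub_distrib, sum_faceCenter hB.nonempty]
        rw [← hsum]
        simp [toRealVec]
  obtain ⟨C, hC, hq, t, ht, hqt⟩ := hray
  obtain ⟨A', hA', rfl⟩ := hS.exists_isTile hC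
  obtain ⟨A, j₀, f, hA, h⟩ := h
  obtain ⟨j₁, f₁, h₁⟩ := hS.faceAt_transfer hA hA' hB h (faceCenter_mem hB.nonempty)
    (fun i hi => (faceCenter_pos hi).ne') hq
  obtain ⟨r, hr⟩ := mem_sum_simplexFace.1 hqt
  obtain ⟨u', f', x, hx, h', hux⟩ := h₁.exists_lower hB.nonempty ht hr
  exact ⟨u', x, A', j₁, f', f₁, hA', h', h₁, hx, hux⟩

/-- A face that is the lower end of a link moving the vertex `e_x` to `e_c`: in every tile with
this face that contains `u' + e_c`, the moving component of `u' + e_c` can only be `e_x`. -/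
theorem IsFineMixedSubdivision.eq_of_faceLink {S : Set (Set (Fin d → ℝ))}
    (hS : IsFineMixedSubdivision n d S) {B : Finset (Fin d)} (hB : B.Nontrivial) {c x y : Fin d}
    {u' u : Fin d → ℕ} (h : FaceLink n S B c u' u x) {A : Fin n → Finset (Fin d)}
    (hA : IsTile S A) {j₀ : Fin n} {f : Fin n → Fin d} (hf : FaceAt A B u' j₀ f)
    {s : Fin n → Fin d → ℝ} (hs : IsDecomp A (toRealVec u' + Pi.single c 1) s)
    (hy : s j₀ = Pi.single y 1) : y = x := by
  obtain ⟨A₁, j₁, f', f₁, hA₁, h', h₁, hx, hux⟩ := h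
  set β := faceCenter B with hβ
  have hβm := faceCenter_mem hB.nonempty
  have hconv : ∀ {A : Fin n → Finset (Fin d)} {a b : Fin d → ℝ} {p q : Fin n → Fin d → ℝ},
      IsDecomp A a p → IsDecomp A b q →
      IsDecomp A ((2⁻¹ : ℝ) • a + (2⁻¹ : ℝ) • b) fun j => (2⁻¹ : ℝ) • p j + (2⁻¹ : ℝ) • q j := by
    intro A a b p q hp hq
    refine ⟨fun j => convex_convexHull ℝ _ (hp.1 j) (hq.1 j) (by norm_num) (by norm_num)
      (by norm_num), ?_⟩
    rw [Finset.sum_add_distrib, ← Finset.smul_sum, ← Finset.smul_sum, hp.2, hq.2]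
  have e : toRealVec u + Pi.single x 1 = toRealVec u' + Pi.single c 1 := by
    rw [← toRealVec_single, ← toRealVec_single, ← toRealVec_add, ← toRealVec_add, hux]
  -- The midpoint of `u' + β` and `u' + e_c = u + e_x`. Its minimal face in the tile of the link
  -- contains `u + e_b` for all `b ∈ B`, so these points lie in the tile of `A` too.
  have hz₁ := hconv (h'.isDecomp (simplexFace_mono h'.1 hβm))
    (h₁.isDecomp (single_mem_simplexFace (h₁.1 hx)))
  have hz := hconv (hf.isDecomp (simplexFace_mono hf.1 hβm)) hs
  rw [← e] at hz
  obtain ⟨b, hbB, hbx⟩ := hB.exists_ne x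
  obtain ⟨r, hr, -⟩ := hS.exists_decomp hA₁ hA hz₁
    (h₁.isDecomp (single_mem_simplexFace (h₁.1 hbB))) hz fun j i hi => by
      by_cases hj : j = j₁
      · subst hj
        rw [vertDecomp_self] at hi
        have hib : i = b := by
          by_contra hne; simp [hne] at hi
        subst hib
        have := faceCenter_pos hbB
        simp [hbx, this.ne']
      · rw [vertDecomp_of_ne hj] at hi
        have hib : i = f₁ j := by
          by_contra hne; simp [hne] at hi
        subst hib
        have h0 : (0 : ℝ) ≤ (Pi.single (f' j) (1 : ℝ) : Fin d → ℝ) (f₁ j) :=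
          (Pi.single_nonneg.2 zero_le_one : (0 : Fin d → ℝ) ≤ Pi.single (f' j) 1) _
        simp only [vertDecomp_of_ne hj, Pi.add_apply, Pi.smul_apply, smul_eq_mul,
          Pi.single_eq_same]
        positivity
  -- Going from `u + e_x` to `u + e_b` turns the component `e_y` into `e_y + e_b - e_x`, which is
  -- nonnegative at `x` only if `y = x`.
  have hw := hA.1.decomp_add hs hr j₀ (w := Pi.single b 1 - Pi.single x 1)
    (fun i hi => by
      have h1 : i ≠ b := by rintro rfl; exact hi (hf.1 hbB)
      have h2 : i ≠ x := by rintro rfl; exact hi (hf.1 hx)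
      simp [h1, h2])
    (by simp) (by rw [← e]; abel)
  have h0 := (mem_simplexFace.1 (hr.1 j₀)).1 x
  rw [hw.1, hy] at h0
  by_contra hne
  simp only [Pi.add_apply, Pi.sub_apply, Pi.single_eq_of_ne (Ne.symm hne),
    Pi.single_eq_of_ne hbx.symm, Pi.single_eq_same] at h0
  norm_num at h0

/-- In the tile of the second link the moving component of `u' + e_c = u₂ + e_{x₂}` is `e_{x₂}`, so
`eq_of_faceLink` for the first link gives `x₂ = x₁`. -/
theorem IsFineMixedSubdivision.upper_unique {S : Set (Set (Fin d → ℝ))}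
    (hS : IsFineMixedSubdivision n d S) {B : Finset (Fin d)} (hB : B.Nontrivial) {c x₁ x₂ : Fin d}
    {u' u₁ u₂ : Fin d → ℕ} (h₁ : FaceLink n S B c u' u₁ x₁) (h₂ : FaceLink n S B c u' u₂ x₂) :
    u₁ = u₂ := by
  have e₁ := h₁.add_single
  obtain ⟨A, j₀, f', f, hA, h', h, hx, hux⟩ := h₂
  have hd := h.isDecomp (single_mem_simplexFace (h.1 hx))
  rw [← toRealVec_single, ← toRealVec_add, hux, toRealVec_add, toRealVec_single] at hd
  have := hS.eq_of_faceLink hB h₁ hA h' hd (y := x₂)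
    (by rw [vertDecomp_self, toRealVec_single])
  rw [this, ← e₁] at hux
  exact (add_right_cancel hux).symm

/-- In a tile with the larger face, the moving component of `u' + e_c` is `e_c`, and
`eq_of_faceLink` would put `c = x` in `B`. -/
theorem IsFineMixedSubdivision.not_hasFace_insert {S : Set (Set (Fin d → ℝ))}
    (hS : IsFineMixedSubdivision n d S) {B : Finset (Fin d)} (hB : B.Nontrivial) {c x : Fin d}
    (hc : c ∉ B) {u' u : Fin d → ℕ} (h : FaceLink n S B c u' u x) :
    ¬ HasFace n S (insert c B) u' := by
  rintro ⟨A, j₀, f, hA, hf⟩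
  have hd := hf.isDecomp (single_mem_simplexFace (hf.1 (Finset.mem_insert_self c B)))
  have hcx := hS.eq_of_faceLink hB h hA (f := f)
    ⟨(Finset.subset_insert c B).trans hf.1, hf.2⟩ hd (vertDecomp_self _ _ _)
  obtain ⟨_, _, _, _, _, _, _, hx, _⟩ := h
  exact hc (hcx ▸ hx)

/-- One point just beyond `u + Δ_B`, away from `e_c`, lies in both tiles. Its minimal face in the
first contains `u₁ + e_b`, so the second tile contains `u₁ + e_b` as well as `u₂ + e_b`. These
differ by `e_{x₁} - e_{x₂}`, and nonnegativity of a component forces `x₁ = x₂`. -/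
theorem IsFineMixedSubdivision.lower_unique {S : Set (Set (Fin d → ℝ))}
    (hS : IsFineMixedSubdivision n d S) {B : Finset (Fin d)} (hB : B.Nontrivial) {c x₁ x₂ : Fin d}
    {u₁ u₂ u : Fin d → ℕ} (h₁ : FaceLink n S B c u₁ u x₁) (h₂ : FaceLink n S B c u₂ u x₂) :
    u₁ = u₂ := by
  have e₁ := h₁.add_single
  have e₂ := h₂.add_single
  suffices hx : x₁ = x₂ by
    rw [hx, e₂] at e₁
    exact (add_right_cancel e₁).symm
  obtain ⟨A₁, j₁, f₁, g₁, hA₁, hf₁, hg₁, hx₁, -⟩ := h₁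
  obtain ⟨A₂, j₂, f₂, g₂, hA₂, hf₂, hg₂, hx₂, -⟩ := h₂
  have e₁' : toRealVec u + Pi.single x₁ 1 = toRealVec u₁ + Pi.single c 1 := by
    rw [← toRealVec_single, ← toRealVec_single, ← toRealVec_add, ← toRealVec_add, e₁]
  have e₂' : toRealVec u + Pi.single x₂ 1 = toRealVec u₂ + Pi.single c 1 := by
    rw [← toRealVec_single, ← toRealVec_single, ← toRealVec_add, ← toRealVec_add, e₂]
  set β := faceCenter B with hβ
  -- With this step length the coordinate of `β + s(β - e_x)` at `x` is `s²`, still positive; and `s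
  -- ≤ 1` allows it as a convex weight.
  set s : ℝ := (B.card : ℝ)⁻¹ with hs
  have hcard : 0 < (B.card : ℝ) := by exact_mod_cast hB.nonempty.card_pos
  have hs0 : 0 < s := by positivity
  have hs1 : s ≤ 1 := inv_le_one_of_one_le₀ (by exact_mod_cast hB.nonempty.card_pos)
  have hβs : ∀ i ∈ B, β i = s := fun i hi => if_pos hi
  -- the component at the moving vertices of a point below the face, in the two tiles
  have hκ : ∀ x ∈ B, β + s • (β - Pi.single x 1) ∈ simplexFace B ∧
      ∀ i ∈ B, 0 < (β + s • (β - Pi.single x 1) : Fin d → ℝ) i := by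
    intro x hx
    have hpos : ∀ i ∈ B, 0 < (β + s • (β - Pi.single x 1) : Fin d → ℝ) i := by
      intro i hi
      simp only [Pi.add_apply, Pi.smul_apply, Pi.sub_apply, smul_eq_mul, hβs i hi]
      by_cases hix : i = x
      · subst hix
        rw [Pi.single_eq_same]
        nlinarith
      · rw [Pi.single_eq_of_ne hix]; nlinarith
    have hzero : ∀ i ∉ B, (β + s • (β - Pi.single x 1) : Fin d → ℝ) i = 0 := by
      intro i hi
      have : i ≠ x := by rintro rfl; exact hi hx
      simp [hβ, faceCenter_of_notMem hi, this]
    refine ⟨mem_simplexFace.2 ⟨fun i => ?_, hzero, ?_⟩, hpos⟩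
    · by_cases hi : i ∈ B
      · exact (hpos i hi).le
      · exact (hzero i hi).ge
    · simp [Finset.sum_add_distrib, ← Finset.mul_sum, hβ, sum_faceCenter hB.nonempty]
  -- The shift `s(u' - u) = s(e_x - e_c)` cancels the dependence on `x`, so the two tiles decompose
  -- the same point.
  have hdec : ∀ {A : Fin n → Finset (Fin d)} {j₀ : Fin n} {f' f : Fin n → Fin d} {x : Fin d}
      {u' : Fin d → ℕ}, FaceAt A B u' j₀ f' → FaceAt A B u j₀ f → x ∈ B →
      toRealVec u + Pi.single x 1 = toRealVec u' + Pi.single c 1 →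
      IsDecomp A (toRealVec u + β + s • (β - Pi.single c 1)) fun j =>
        (1 - s) • vertDecomp j₀ f (β + s • (β - Pi.single x 1)) j +
          s • vertDecomp j₀ f' (β + s • (β - Pi.single x 1)) j := by
    intro A j₀ f' f x u' hf' hf hx e
    have hκx := (hκ x hx).1
    have d1 := hf.isDecomp (simplexFace_mono hf.1 hκx)
    have d2 := hf'.isDecomp (simplexFace_mono hf'.1 hκx)
    refine ⟨fun j => convex_convexHull ℝ _ (d1.1 j) (d2.1 j) (sub_nonneg.2 hs1) hs0.le
      (by ring), ?_⟩
    rw [Finset.sum_add_distrib, ← Finset.smul_sum, ← Finset.smul_sum, d1.2, d2.2,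
      eq_sub_of_add_eq e.symm]
    module
  obtain ⟨b, hbB, hbx⟩ := hB.exists_ne x₂
  obtain ⟨r, hr, -⟩ := hS.exists_decomp hA₁ hA₂ (hdec hf₁ hg₁ hx₁ e₁')
    (hf₁.isDecomp (single_mem_simplexFace (hf₁.1 hbB))) (hdec hf₂ hg₂ hx₂ e₂') fun j i hi => by
      by_cases hj : j = j₁
      · subst hj
        rw [vertDecomp_self] at hi
        have hib : i = b := by
          by_contra hne; simp [hne] at hi
        subst hib
        have := (hκ x₁ hx₁).2 i hbB
        simp only [vertDecomp_self, ← add_smul, sub_add_cancel, one_smul]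
        exact this.ne'
      · rw [vertDecomp_of_ne hj] at hi
        have hib : i = f₁ j := by
          by_contra hne; simp [hne] at hi
        subst hib
        have h0 : (0 : ℝ) ≤ (Pi.single (g₁ j) (1 : ℝ) : Fin d → ℝ) (f₁ j) :=
          (Pi.single_nonneg.2 zero_le_one : (0 : Fin d → ℝ) ≤ Pi.single (g₁ j) 1) _
        simp only [vertDecomp_of_ne hj, Pi.add_apply, Pi.smul_apply, smul_eq_mul,
          Pi.single_eq_same]
        have := mul_nonneg (sub_nonneg.2 hs1) h0
        positivity
  have hw := hA₂.1.decomp_add (hf₂.isDecomp (single_mem_simplexFace (hf₂.1 hbB))) hr j₂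
    (w := Pi.single x₁ 1 - Pi.single x₂ 1)
    (fun i hi => by
      have h1 : i ≠ x₁ := by rintro rfl; exact hi (hf₂.1 hx₁)
      have h2 : i ≠ x₂ := by rintro rfl; exact hi (hf₂.1 hx₂)
      simp [h1, h2])
    (by simp)
    (by rw [eq_sub_of_add_eq e₁'.symm, eq_sub_of_add_eq e₂'.symm]; abel)
  have h0 := (mem_simplexFace.1 (hr.1 j₂)).1 x₂
  rw [hw.1, vertDecomp_self] at h0
  by_contra hne
  simp only [Pi.add_apply, Pi.sub_apply, Pi.single_eq_of_ne (Ne.symm hne),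
    Pi.single_eq_of_ne hbx.symm, Pi.single_eq_same] at h0
  norm_num at h0

end Links

/-! ### Counting faces level by level -/

section Counting

variable {n d : ℕ}

/-- Pushing the barycenter towards `e_c`, some summand gains mass at `c`. If it is the one carrying
`B`, the face extends by `c`. Otherwise its vertex lies in `B`, since `u'` vanishes outside `B ∪
{c}`, and exchanging that vertex for `c` gives the link. -/
theorem IsFineMixedSubdivision.exists_upper {S : Set (Set (Fin d → ℝ))}
    (hS : IsFineMixedSubdivision n d S) {B : Finset (Fin d)} (hB : B.Nontrivial) {u' : Fin d → ℕ}
    (h : HasFace n S B u') {c : Fin d} (hc : c ∉ B) (hu' : ∀ i ∉ B, i ≠ c → u' i = 0) :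
    HasFace n S (insert c B) u' ∨ ∃ u x, FaceLink n S B c u' u x := by
  have hsum := h.sum_add_one
  have hray := hS.exists_tile_of_ray (q := toRealVec u' + faceCenter B)
    (w := Pi.single c 1 - faceCenter B) one_pos fun t ht0 ht1 => by
      refine mem_dilatedSimplex (by omega) (fun i => ?_) ?_
      · have h1 := faceCenter_nonneg B i
        have h2 : (0 : ℝ) ≤ (Pi.single c (1 : ℝ) : Fin d → ℝ) i :=
          (Pi.single_nonneg.2 zero_le_one : (0 : Fin d → ℝ) ≤ Pi.single c 1) _
        have h3 := toRealVec_nonneg u' i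
        simp only [Pi.add_apply, Pi.smul_apply, Pi.sub_apply, smul_eq_mul]
        nlinarith
      · simp only [Pi.add_apply, Pi.smul_apply, Pi.sub_apply, smul_eq_mul, Finset.sum_add_distrib,
          ← Finset.mul_sum, Finset.sum_sub_distrib, sum_faceCenter hB.nonempty]
        rw [← hsum]
        simp [toRealVec]
  obtain ⟨C, hC, hq, t, ht, hqt⟩ := hray
  obtain ⟨A', hA', rfl⟩ := hS.exists_isTile hC
  obtain ⟨A, j₀, f, hA, h⟩ := h
  obtain ⟨j₁, f₁, h₁⟩ := hS.faceAt_transfer hA hA' hB h (faceCenter_mem hB.nonempty)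
    (fun i hi => (faceCenter_pos hi).ne') hq
  obtain ⟨r, hr⟩ := mem_sum_simplexFace.1 hqt
  have hp := h₁.isDecomp (simplexFace_mono h₁.1 (faceCenter_mem hB.nonempty))
  have hex : ∃ j, vertDecomp j₁ f₁ (faceCenter B) j c < r j c := by
    by_contra! hno
    have h1 := Finset.sum_le_sum fun j (_ : j ∈ Finset.univ) => hno j
    have e1 := congrFun hr.2 c
    have e2 := congrFun hp.2 c
    simp only [Finset.sum_apply, Pi.add_apply, Pi.smul_apply, Pi.sub_apply, smul_eq_mul,
      faceCenter_of_notMem hc, Pi.single_eq_same] at e1 e2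
    rw [e1, e2] at h1
    linarith
  obtain ⟨j, hj⟩ := hex
  have hcj : c ∈ A' j := by
    by_contra hcj
    rw [(mem_simplexFace.1 (hr.1 j)).2.1 c hcj] at hj
    exact hj.not_ge ((mem_simplexFace.1 (hp.1 j)).1 c)
  by_cases hjj : j = j₁
  · subst hjj
    exact Or.inl ⟨A', j, f₁, hA', Finset.insert_subset hcj h₁.1, h₁.2⟩
  · right
    have hmem := Finset.mem_erase.2 ⟨hjj, Finset.mem_univ j⟩
    have hfc : f₁ j ≠ c := by
      rintro hfc
      rw [vertDecomp_of_ne hjj, hfc, Pi.single_eq_same] at hj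
      exact hj.not_ge (le_one_of_mem_simplexFace (hr.1 j) c)
    have hfB : f₁ j ∈ B := by
      by_contra hfB
      have h0 := hu' _ hfB hfc
      rw [h₁.2.2, Finset.sum_apply, Finset.sum_eq_zero_iff] at h0
      simpa using h0 j hmem
    refine ⟨∑ k ∈ Finset.univ.erase j₁, Pi.single (Function.update f₁ j c k) 1, f₁ j, A', j₁,
      f₁, Function.update f₁ j c, hA', h₁, ⟨h₁.1, fun k hk => ?_, rfl⟩, hfB, ?_⟩
    · by_cases hkj : k = j
      · subst hkj; simpa using hcj
      · rw [Function.update_of_ne hkj]; exact h₁.2.1 k hk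
    · rw [sum_single_update f₁ hmem c, h₁.2.2]

theorem single_exchange {u u' : Fin d → ℕ} {x c : Fin d} (hxc : x ≠ c)
    (h : u + Pi.single x 1 = u' + Pi.single c 1) :
    u c = u' c + 1 ∧ (∀ i ≠ c, u i ≤ u' i) ∧ ∀ i ≠ c, i ≠ x → u i = u' i := by
  have h1 := fun i => congrFun h i
  refine ⟨?_, fun i hi => ?_, fun i hi hix => ?_⟩
  · simpa [hxc.symm] using h1 c
  · have := h1 i
    simp only [Pi.add_apply, Pi.single_eq_of_ne hi, add_zero] at this
    omega
  · simpa [hi, hix] using h1 i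

theorem FaceLink.ne {S : Set (Set (Fin d → ℝ))} {B : Finset (Fin d)} {c x : Fin d}
    {u' u : Fin d → ℕ} (h : FaceLink n S B c u' u x) (hc : c ∉ B) : x ∈ B ∧ x ≠ c := by
  obtain ⟨_, _, _, _, _, _, _, hx, _⟩ := h
  exact ⟨hx, by rintro rfl; exact hc hx⟩

/-- The translates of the face spanned by `B` that lie above `v`, at the levels `v c`, `c ∉ B`. -/
def facesAbove (n : ℕ) (S : Set (Set (Fin d → ℝ))) (B : Finset (Fin d)) (v : Fin d → ℕ) :
    Set (Fin d → ℕ) :=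
  {u | HasFace n S B u ∧ v ≤ u ∧ ∀ i ∉ B, u i = v i}

/-- The translates of the face spanned by `B` that lie above `v`, at the levels `v i` for `i ∉ B`
other than `c`, and at the level `h` for `c`. -/
def facesAtLevel (n : ℕ) (S : Set (Set (Fin d → ℝ))) (B : Finset (Fin d)) (c : Fin d)
    (v : Fin d → ℕ) (h : ℕ) : Set (Fin d → ℕ) :=
  {u | HasFace n S B u ∧ v ≤ u ∧ (∀ i ∉ B, i ≠ c → u i = v i) ∧ u c = h}

theorem finite_of_hasFace {S : Set (Set (Fin d → ℝ))} {B : Finset (Fin d)}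
    {K : Set (Fin d → ℕ)} (h : ∀ u ∈ K, HasFace n S B u) : K.Finite :=
  (simplexPoints_finite n d).subset fun u hu => (h u hu).sum_add_one

theorem HasFace.lt {S : Set (Set (Fin d → ℝ))} {B : Finset (Fin d)} {u : Fin d → ℕ}
    (h : HasFace n S B u) (i : Fin d) : u i < n := by
  have h1 := h.sum_add_one
  have h2 : u i ≤ ∑ j, u j := Finset.single_le_sum (fun _ _ => Nat.zero_le _) (Finset.mem_univ i)
  omega

theorem facesAtLevel_self {S : Set (Set (Fin d → ℝ))} {B : Finset (Fin d)} {c : Fin d}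
    (hc : c ∉ B) (v : Fin d → ℕ) : facesAtLevel n S B c v (v c) = facesAbove n S B v := by
  ext u
  refine and_congr_right fun _ => and_congr_right fun _ => ⟨fun h i hi => ?_, fun h => ?_⟩
  · by_cases hic : i = c
    · subst hic; exact h.2
    · exact h.1 i hi hic
  · exact ⟨fun i hi _ => h i hi, h c hc⟩

theorem ncard_facesAbove_ge_succ {S : Set (Set (Fin d → ℝ))} (B : Finset (Fin d)) (c : Fin d)
    (v : Fin d → ℕ) (h : ℕ) :
    (facesAbove n S B v ∩ {u | h ≤ u c}).ncard =
      (facesAbove n S B v ∩ {u | u c = h}).ncard +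
        (facesAbove n S B v ∩ {u | h + 1 ≤ u c}).ncard := by
  have hfin : (facesAbove n S B v).Finite := finite_of_hasFace fun u hu => hu.1
  rw [← Set.ncard_union_eq ?_ (hfin.inter_of_left _) (hfin.inter_of_left _),
    ← Set.inter_union_distrib_left]
  · congr 2
    ext u
    simp only [Set.mem_ofPred_eq, Set.mem_union]
    omega
  · rw [Set.disjoint_left]
    rintro u ⟨-, hu⟩ ⟨-, hu'⟩
    simp only [Set.mem_ofPred_eq] at hu hu'
    omega

theorem facesAbove_inter_level_subset {S : Set (Set (Fin d → ℝ))} {B : Finset (Fin d)}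
    {c : Fin d} (v : Fin d → ℕ) (h : ℕ) :
    facesAbove n S (insert c B) v ∩ {u | u c = h} ⊆ facesAtLevel n S B c v h := by
  rintro u ⟨⟨h1, h2, h3⟩, h4⟩
  exact ⟨h1.mono (Finset.subset_insert _ _), h2,
    fun i hi hic => h3 i (by simp [hi, hic]), h4⟩

/-- Descending induction on the level, from `N_h + L_{h+1} ≤ L_h`. The downward map keeps `v ≤ u`
because only the coordinate at `c` decreases, to `h ≥ v c`. -/
theorem IsFineMixedSubdivision.ncard_facesAbove_le_level {S : Set (Set (Fin d → ℝ))}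
    (hS : IsFineMixedSubdivision n d S) {B : Finset (Fin d)} (hB : B.Nontrivial) {c : Fin d}
    (hc : c ∉ B) (v : Fin d → ℕ) (k h : ℕ) (hk : h + k = n) (hv : v c ≤ h) :
    (facesAbove n S (insert c B) v ∩ {u | h ≤ u c}).ncard ≤ (facesAtLevel n S B c v h).ncard := by
  induction k generalizing h with
  | zero =>
    have : facesAbove n S (insert c B) v ∩ {u | h ≤ u c} = ∅ := by
      rw [Set.eq_empty_iff_forall_notMem]
      rintro u ⟨hu, hu'⟩
      have := hu.1.lt c
      simp only [Set.mem_ofPred_eq] at hu'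
      omega
    simp [this]
  | succ k ih =>
    have hfin : ∀ h, (facesAtLevel n S B c v h).Finite := fun h =>
      finite_of_hasFace fun u hu => hu.1
    have hex : ∀ u, u ∈ facesAtLevel n S B c v (h + 1) → ∃ u' x, FaceLink n S B c u' u x :=
      fun u hu => hS.exists_lower hB hu.1 (by rw [hu.2.2.2]; omega)
    choose! φ x hφ using hex
    have hmaps : ∀ u ∈ facesAtLevel n S B c v (h + 1), φ u ∈ facesAtLevel n S B c v h := by
      intro u hu
      have hl := hφ u hu
      obtain ⟨hx, hxc⟩ := hl.ne hc
      obtain ⟨e1, e2, e3⟩ := single_exchange hxc hl.add_single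
      have huc := hu.2.2.2
      have hφc : φ u c = h := by omega
      refine ⟨hl.lower, fun i => ?_, fun i hi hic => ?_, hφc⟩
      · by_cases hic : i = c
        · subst hic; rw [hφc]; exact hv
        · exact (hu.2.1 i).trans (e2 i hic)
      · rw [← e3 i hic (by rintro rfl; exact hi hx)]
        exact hu.2.2.1 i hi hic
    have hinj : Set.InjOn φ (facesAtLevel n S B c v (h + 1)) := by
      intro u₁ hu₁ u₂ hu₂ he
      have h1 := hφ u₁ hu₁
      have h2 := hφ u₂ hu₂
      rw [← he] at h2
      exact hS.upper_unique hB h1 h2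
    have hdisj : Disjoint (facesAbove n S (insert c B) v ∩ {u | u c = h})
        (φ '' facesAtLevel n S B c v (h + 1)) := by
      rw [Set.disjoint_left]
      rintro _ ⟨hu, -⟩ ⟨u, hu', rfl⟩
      exact hS.not_hasFace_insert hB hc (hφ u hu') hu.1
    rw [ncard_facesAbove_ge_succ]
    calc _ ≤ (facesAbove n S (insert c B) v ∩ {u | u c = h}).ncard +
          (facesAtLevel n S B c v (h + 1)).ncard :=
            Nat.add_le_add_left (ih (h + 1) (by omega) (by omega)) _
      _ = (facesAbove n S (insert c B) v ∩ {u | u c = h} ∪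
          φ '' facesAtLevel n S B c v (h + 1)).ncard := by
            rw [Set.ncard_union_eq hdisj ((hfin h).subset (facesAbove_inter_level_subset v h))
              ((hfin _).image _), hinj.ncard_image]
      _ ≤ _ := Set.ncard_le_ncard (Set.union_subset (facesAbove_inter_level_subset v h)
            (Set.image_subset_iff.2 hmaps)) (hfin h)

theorem IsFineMixedSubdivision.ncard_facesAbove_insert_le {S : Set (Set (Fin d → ℝ))}
    (hS : IsFineMixedSubdivision n d S) {B : Finset (Fin d)} (hB : B.Nontrivial) {c : Fin d}
    (hc : c ∉ B) (v : Fin d → ℕ) :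
    (facesAbove n S (insert c B) v).ncard ≤ (facesAbove n S B v).ncard := by
  by_cases hv : v c ≤ n
  · have h1 := hS.ncard_facesAbove_le_level hB hc v (n - v c) (v c) (by omega) le_rfl
    rwa [facesAtLevel_self hc, Set.inter_eq_left.2 fun u hu => hu.2.1 c] at h1
  · have : facesAbove n S (insert c B) v = ∅ := by
      rw [Set.eq_empty_iff_forall_notMem]
      intro u hu
      have h1 := hu.1.lt c
      have h2 : v c ≤ u c := hu.2.1 c
      omega
    simp [this]

/-- Descending induction from `L_h ≤ N_h + L_{h+1}`. Here `v = 0` matters: the upward move needs the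
coordinates outside `B ∪ {c}` to vanish, and it lowers a coordinate in `B`. -/
theorem IsFineMixedSubdivision.ncard_level_le {S : Set (Set (Fin d → ℝ))}
    (hS : IsFineMixedSubdivision n d S) {B : Finset (Fin d)} (hB : B.Nontrivial) {c : Fin d}
    (hc : c ∉ B) (k h : ℕ) (hk : h + k = n) :
    (facesAtLevel n S B c 0 h).ncard ≤
      (facesAbove n S (insert c B) 0 ∩ {u | h ≤ u c}).ncard := by
  induction k generalizing h with
  | zero =>
    have : facesAtLevel n S B c 0 h = ∅ := by
      rw [Set.eq_empty_iff_forall_notMem]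
      intro u hu
      have := hu.1.lt c
      have := hu.2.2.2
      omega
    simp [this]
  | succ k ih =>
    have hfin : ∀ h, (facesAtLevel n S B c 0 h).Finite := fun h =>
      finite_of_hasFace fun u hu => hu.1
    set N := facesAbove n S (insert c B) 0 ∩ {u | u c = h} with hN
    have hex : ∀ u', u' ∈ facesAtLevel n S B c 0 h \ N → ∃ u x, FaceLink n S B c u' u x := by
      rintro u' ⟨hu', hu'N⟩
      refine (hS.exists_upper hB hu'.1 hc hu'.2.2.1).resolve_left fun hface => hu'N ?_
      refine ⟨⟨hface, hu'.2.1, fun i hi => ?_⟩, hu'.2.2.2⟩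
      rw [Finset.mem_insert, not_or] at hi
      exact hu'.2.2.1 i hi.2 hi.1
    choose! ψ x hψ using hex
    have hmaps : ∀ u' ∈ facesAtLevel n S B c 0 h \ N, ψ u' ∈ facesAtLevel n S B c 0 (h + 1) := by
      intro u' hu'
      have hl := hψ u' hu'
      obtain ⟨hx, hxc⟩ := hl.ne hc
      obtain ⟨e1, e2, e3⟩ := single_exchange hxc hl.add_single
      have huc := hu'.1.2.2.2
      refine ⟨hl.upper, fun i => Nat.zero_le _, fun i hi hic => ?_, by omega⟩
      rw [e3 i hic (by rintro rfl; exact hi hx)]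
      exact hu'.1.2.2.1 i hi hic
    have hinj : Set.InjOn ψ (facesAtLevel n S B c 0 h \ N) := by
      intro u₁ hu₁ u₂ hu₂ he
      have h1 := hψ u₁ hu₁
      have h2 := hψ u₂ hu₂
      rw [← he] at h2
      exact hS.lower_unique hB h1 h2
    rw [ncard_facesAbove_ge_succ]
    have h1 := Set.ncard_le_ncard_of_injOn ψ hmaps hinj (hfin (h + 1))
    have h2 := ih (h + 1) (by omega)
    have h3 := Set.ncard_sdiff_add_ncard_of_subset
      (facesAbove_inter_level_subset (n := n) (S := S) (B := B) (c := c) 0 h) (hfin h)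
    rw [← hN] at h3 ⊢
    omega

theorem IsFineMixedSubdivision.ncard_facesAbove_zero_le_insert {S : Set (Set (Fin d → ℝ))}
    (hS : IsFineMixedSubdivision n d S) {B : Finset (Fin d)} (hB : B.Nontrivial) {c : Fin d}
    (hc : c ∉ B) :
    (facesAbove n S B 0).ncard ≤ (facesAbove n S (insert c B) 0).ncard := by
  have h1 := hS.ncard_level_le hB hc n 0 (by omega)
  have h2 := facesAtLevel_self (n := n) (S := S) hc 0
  rw [Pi.zero_apply] at h2
  rwa [h2, Set.inter_eq_left.2 fun u _ => Nat.zero_le (u c)] at h1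

/-- The coordinate sum is `n - 1` and the coordinates off `{a, b}` are fixed, so `u` is determined
by `u a`, which ranges over `n - ∑ v i` integers from `v a` on. -/
theorem ncard_facesAbove_pair_le {S : Set (Set (Fin d → ℝ))} {a b : Fin d} (v : Fin d → ℕ) :
    (facesAbove n S {a, b} v).ncard ≤ n - ∑ i, v i := by
  have hle : ∀ w : Fin d → ℕ, ∑ i, w i = w a + ∑ i ∈ Finset.univ.erase a, w i := fun w =>
    (Finset.add_sum_erase _ _ (Finset.mem_univ a)).symm
  have hcard : (Finset.Ico (v a) (v a + (n - ∑ i, v i)) : Set ℕ).ncard = n - ∑ i, v i := by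
    rw [Set.ncard_coe_finset, Nat.card_Ico, Nat.add_sub_cancel_left]
  rw [← hcard]
  refine Set.ncard_le_ncard_of_injOn (fun u => u a) (fun u hu => ?_) ?_ (Finset.finite_toSet _)
  · have h1 := hu.1.sum_add_one
    have h2 : v a ≤ u a := hu.2.1 a
    have h3 : ∑ i ∈ Finset.univ.erase a, v i ≤ ∑ i ∈ Finset.univ.erase a, u i :=
      Finset.sum_le_sum fun i _ => hu.2.1 i
    have h4 := hle u
    have h5 := hle v
    simp only [Finset.coe_Ico, Set.mem_Ico]
    omega
  · intro u hu w hw huw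
    have h1 := hu.1.sum_add_one
    have h2 := hw.1.sum_add_one
    have h3 : ∀ i, i ≠ b → u i = w i := fun i hib => by
      by_cases hia : i = a
      · subst hia; exact huw
      · rw [hu.2.2 i (by simp [hia, hib]), hw.2.2 i (by simp [hia, hib])]
    have h4 : ∑ i ∈ Finset.univ.erase b, u i = ∑ i ∈ Finset.univ.erase b, w i :=
      Finset.sum_congr rfl fun i hi => h3 i (Finset.ne_of_mem_erase hi)
    have h5 := Finset.add_sum_erase Finset.univ u (Finset.mem_univ b)
    have h6 := Finset.add_sum_erase Finset.univ w (Finset.mem_univ b)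
    funext i
    by_cases hib : i = b
    · subst hib; omega
    · exact h3 i hib

/-- Every unit segment of an edge of the dilated simplex is a face of a tile. -/
theorem IsFineMixedSubdivision.hasFace_pair {S : Set (Set (Fin d → ℝ))}
    (hS : IsFineMixedSubdivision n d S) {a b : Fin d} (hab : a ≠ b) {u : Fin d → ℕ}
    (hsum : ∑ i, u i + 1 = n) (hu : ∀ i, i ≠ a → i ≠ b → u i = 0) : HasFace n S {a, b} u := by
  have hBne : ({a, b} : Finset (Fin d)).Nonempty := ⟨a, by simp⟩
  have hcard : ({a, b} : Finset (Fin d)).card = 2 := Finset.card_pair hab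
  have hβa : faceCenter ({a, b} : Finset (Fin d)) a = 2⁻¹ := by simp [faceCenter, hcard]
  have hβb : faceCenter ({a, b} : Finset (Fin d)) b = 2⁻¹ := by simp [faceCenter, hcard]
  have hq : toRealVec u + faceCenter {a, b} ∈ dilatedSimplex n d := by
    refine mem_dilatedSimplex (by omega) (fun i => ?_) ?_
    · exact add_nonneg (toRealVec_nonneg u i) (faceCenter_nonneg _ i)
    · simp only [Pi.add_apply, Finset.sum_add_distrib, sum_faceCenter hBne]
      rw [← hsum]; simp [toRealVec]
  rw [← hS.cover] at hq
  obtain ⟨C, hC, hqC⟩ := hq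
  obtain ⟨A, hA, rfl⟩ := hS.exists_isTile hC
  obtain ⟨p, hp⟩ := mem_sum_simplexFace.1 hqC
  have hp0 : ∀ j i, p j i ≠ 0 → i = a ∨ i = b := by
    intro j i hi
    by_contra! hne
    have h1 := congrFun hp.2 i
    rw [Finset.sum_apply, Pi.add_apply, faceCenter_of_notMem (by simp [hne.1, hne.2]),
      toRealVec, hu i hne.1 hne.2, Nat.cast_zero, add_zero,
      Finset.sum_eq_zero_iff_of_nonneg fun j _ => (mem_simplexFace.1 (hp.1 j)).1 i] at h1
    exact hi (h1 j (Finset.mem_univ j))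
  have hmemA : ∀ j i, p j i ≠ 0 → i ∈ A j := fun j i hi => by
    by_contra hiA; exact hi ((mem_simplexFace.1 (hp.1 j)).2.1 i hiA)
  have hne : ∀ j, ∃ i, p j i ≠ 0 := fun j => exists_ne_zero_of_mem_simplexFace (hp.1 j)
  choose g hg using hne
  have hvert : ∀ j, ¬ (p j a ≠ 0 ∧ p j b ≠ 0) → p j = Pi.single (g j) 1 := by
    intro j hj
    refine eq_single_of_support (hp.1 j) fun i hi => ?_
    have hgj := hg j
    rcases hp0 j i hi with rfl | rfl <;> rcases hp0 j (g j) hgj with h | h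
    · exact h.symm
    · rw [h] at hgj; exact absurd ⟨hi, hgj⟩ hj
    · rw [h] at hgj; exact absurd ⟨hgj, hi⟩ hj
    · exact h.symm
  -- Otherwise the midpoint would be a lattice point, but its coordinate at `a` is half-integral.
  have hj₁ : ∃ j₁, p j₁ a ≠ 0 ∧ p j₁ b ≠ 0 := by
    by_contra hno
    rw [not_exists] at hno
    have h1 : ∑ j, p j = toRealVec (∑ j, Pi.single (g j) 1) := by
      rw [toRealVec_sum]
      exact Finset.sum_congr rfl fun j _ => by rw [hvert j (hno j), toRealVec_single]
    have h2 := congrFun (h1.symm.trans hp.2) a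
    rw [Pi.add_apply, hβa] at h2
    simp only [toRealVec] at h2
    set m : ℕ := (∑ j, (Pi.single (g j) 1 : Fin d → ℕ)) a
    have h3 : ((2 * m : ℕ) : ℝ) = (2 * u a + 1 : ℕ) := by push_cast; linarith
    have h4 : 2 * m = 2 * u a + 1 := by exact_mod_cast h3
    omega
  obtain ⟨j₁, ha, hb⟩ := hj₁
  have hp1 : ∀ j ≠ j₁, p j = Pi.single (g j) 1 := fun j hj => hvert j fun h =>
    hj (hA.1.eq_of_mem hab (hmemA _ _ h.1) (hmemA _ _ h.2) (hmemA _ _ ha) (hmemA _ _ hb))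
  refine ⟨A, j₁, g, hA, ?_, fun j _ => hmemA j _ (hg j), ?_⟩
  · intro i hi
    rw [Finset.mem_insert, Finset.mem_singleton] at hi
    rcases hi with rfl | rfl
    · exact hmemA _ _ ha
    · exact hmemA _ _ hb
  · set w : Fin d → ℕ := ∑ j ∈ Finset.univ.erase j₁, Pi.single (g j) 1 with hw
    have h1 : toRealVec u + faceCenter {a, b} = p j₁ + toRealVec w := by
      rw [← hp.2, ← Finset.add_sum_erase _ _ (Finset.mem_univ j₁), hw, toRealVec_sum]
      simp only [toRealVec_single]
      congr 1
      exact Finset.sum_congr rfl fun j hj => hp1 j (Finset.ne_of_mem_erase hj)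
    -- `u i - w i = p j₁ i - 1/2` has absolute value at most `1/2`, so this integer is zero.
    have hhalf : ∀ i, faceCenter ({a, b} : Finset (Fin d)) i = 2⁻¹ → u i = w i := by
      intro i hi
      have h2 := congrFun h1 i
      have h3 := (mem_simplexFace.1 (hp.1 j₁)).1 i
      have h4 := le_one_of_mem_simplexFace (hp.1 j₁) i
      simp only [Pi.add_apply, hi, toRealVec] at h2
      have h5 : ((2 * w i : ℕ) : ℝ) ≤ (2 * u i + 1 : ℕ) := by push_cast; linarith
      have h6 : ((2 * u i : ℕ) : ℝ) ≤ (2 * w i + 1 : ℕ) := by push_cast; linarith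
      have h5' : 2 * w i ≤ 2 * u i + 1 := by exact_mod_cast h5
      have h6' : 2 * u i ≤ 2 * w i + 1 := by exact_mod_cast h6
      omega
    funext i
    by_cases hia : i = a
    · subst hia; exact hhalf _ hβa
    by_cases hib : i = b
    · subst hib; exact hhalf _ hβb
    have h2 := congrFun h1 i
    have h3 := (mem_simplexFace.1 (hp.1 j₁)).1 i
    rw [Pi.add_apply, Pi.add_apply, faceCenter_of_notMem (by simp [hia, hib]), toRealVec,
      hu i hia hib, Nat.cast_zero, add_zero] at h2
    have h4 := toRealVec_nonneg w i
    have h5 : ((w i : ℕ) : ℝ) = (0 : ℕ) := by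
      have : toRealVec w i = 0 := by linarith
      simpa [toRealVec] using this
    rw [hu i hia hib]
    exact_mod_cast h5.symm

theorem IsFineMixedSubdivision.le_ncard_facesAbove_pair {S : Set (Set (Fin d → ℝ))}
    (hS : IsFineMixedSubdivision n d S) {a b : Fin d} (hab : a ≠ b) :
    n ≤ (facesAbove n S {a, b} 0).ncard := by
  have hfin : (facesAbove n S {a, b} 0).Finite := finite_of_hasFace fun u hu => hu.1
  have hcard : (Finset.range n : Set ℕ).ncard = n := by
    rw [Set.ncard_coe_finset, Finset.card_range]
  conv_lhs => rw [← hcard]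
  refine Set.ncard_le_ncard_of_injOn
    (fun k => Pi.single a k + Pi.single b (n - 1 - k)) (fun k hk => ?_) ?_ hfin
  · have hk' : k < n := by simpa using hk
    have hz : ∀ i, i ≠ a → i ≠ b →
        (Pi.single a k + Pi.single b (n - 1 - k) : Fin d → ℕ) i = 0 := by
      intro i hia hib; simp [hia, hib]
    refine ⟨hS.hasFace_pair hab ?_ hz, fun i => Nat.zero_le _, fun i hi => ?_⟩
    · simp only [Pi.add_apply, Finset.sum_add_distrib, Finset.mem_univ, if_true,
        Pi.single_apply, Finset.sum_ite_eq']
      omega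
    · simp only [Finset.mem_insert, Finset.mem_singleton, not_or] at hi
      exact hz i hi.1 hi.2
  · intro k _ l _ hkl
    simpa [hab] using congrFun hkl a

theorem IsFineMixedSubdivision.ncard_facesAbove_le {S : Set (Set (Fin d → ℝ))}
    (hS : IsFineMixedSubdivision n d S) (hd : 2 ≤ d) (v : Fin d → ℕ) :
    (facesAbove n S Finset.univ v).ncard ≤ n - ∑ i, v i := by
  have : Nontrivial (Fin d) := Fin.nontrivial_iff_two_le.2 hd
  obtain ⟨a, b, hab⟩ := exists_pair_ne (Fin d)
  have key : ∀ T : Finset (Fin d), (facesAbove n S (T ∪ {a, b}) v).ncard ≤ n - ∑ i, v i := by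
    intro T
    induction T using Finset.induction_on with
    | empty => rw [Finset.empty_union]; exact ncard_facesAbove_pair_le v
    | insert c T _ ih =>
      rw [Finset.insert_union]
      by_cases hc : c ∈ T ∪ {a, b}
      · rwa [Finset.insert_eq_of_mem hc]
      · exact (hS.ncard_facesAbove_insert_le ⟨a, by simp, b, by simp, hab⟩ hc v).trans ih
  simpa using key Finset.univ

theorem IsFineMixedSubdivision.le_ncard_facesAbove {S : Set (Set (Fin d → ℝ))}
    (hS : IsFineMixedSubdivision n d S) (hd : 2 ≤ d) :
    n ≤ (facesAbove n S Finset.univ 0).ncard := by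
  have : Nontrivial (Fin d) := Fin.nontrivial_iff_two_le.2 hd
  obtain ⟨a, b, hab⟩ := exists_pair_ne (Fin d)
  have key : ∀ T : Finset (Fin d), n ≤ (facesAbove n S (T ∪ {a, b}) 0).ncard := by
    intro T
    induction T using Finset.induction_on with
    | empty => rw [Finset.empty_union]; exact hS.le_ncard_facesAbove_pair hab
    | insert c T _ ih =>
      rw [Finset.insert_union]
      by_cases hc : c ∈ T ∪ {a, b}
      · rwa [Finset.insert_eq_of_mem hc]
      · exact ih.trans
          (hS.ncard_facesAbove_zero_le_insert ⟨a, by simp, b, by simp, hab⟩ hc)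
  simpa using key Finset.univ

end Counting

/-! ### Simplex tiles and their locations -/

section Locations

variable {n d : ℕ}

theorem HasLocation.unique (hd : 2 ≤ d) {C : Set (Fin d → ℝ)} {x y : Fin d → ℕ}
    (hx : HasLocation C x) (hy : HasLocation C y) : x = y := by
  have : Nontrivial (Fin d) := Fin.nontrivial_iff_two_le.2 hd
  have key : ∀ {x y : Fin d → ℕ}, HasLocation C x → HasLocation C y → ∀ i, x i ≤ y i := by
    intro x y hx hy i
    -- The vertex `y + e_j` has `i`-th coordinate `y i`, while `x i` bounds that coordinate below on
    -- the tile.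
    obtain ⟨j, hj⟩ := exists_ne i
    have hmem : toRealVec y + Pi.single j 1 ∈ C := by
      rw [hy]
      exact ⟨_, single_mem_stdSimplex ℝ j, rfl⟩
    rw [hx] at hmem
    obtain ⟨z, hz, hzy⟩ := hmem
    have h1 := congrFun hzy i
    have h2 := hz.1 i
    simp only [vadd_eq_add, Pi.add_apply, toRealVec, Pi.single_eq_of_ne hj.symm, add_zero] at h1
    have h3 : (x i : ℝ) ≤ y i := by linarith
    exact_mod_cast h3
  exact le_antisymm (key hx hy) (key hy hx)

/-- The summand `A j₀` is everything, so by `eq_of_mem` all others shrink to their vertices `f j`.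
-/
theorem FaceAt.hasLocation {A : Fin n → Finset (Fin d)} (hA : IndepFaces A) {u : Fin d → ℕ}
    {j₀ : Fin n} {f : Fin n → Fin d} (h : FaceAt A Finset.univ u j₀ f) :
    HasLocation (∑ j, simplexFace (A j)) u := by
  have hsub : ∀ j ≠ j₀, ∀ i ∈ A j, i = f j := by
    intro j hj i hi
    by_contra hne
    exact hj (hA.eq_of_mem hne hi (h.2.1 j hj) (h.1 (Finset.mem_univ _))
      (h.1 (Finset.mem_univ _)))
  ext y
  rw [mem_sum_simplexFace]
  constructor
  · rintro ⟨p, hp⟩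
    have hpv : p = vertDecomp j₀ f (p j₀) := by
      funext j
      by_cases hj : j = j₀
      · subst hj; simp
      · rw [vertDecomp_of_ne hj]
        refine eq_single_of_support (hp.1 j) fun i hi => hsub j hj i ?_
        by_contra hiA; exact hi ((mem_simplexFace.1 (hp.1 j)).2.1 i hiA)
    refine ⟨p j₀, ?_, ?_⟩
    · rw [← simplexFace_univ]
      exact simplexFace_mono (Finset.subset_univ _) (hp.1 j₀)
    · rw [← hp.2, hpv, (h.isDecomp (hp.1 j₀)).2]
      simp only [vertDecomp_self, vadd_eq_add]
      rfl
  · rintro ⟨z, hz, rfl⟩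
    rw [← simplexFace_univ] at hz
    exact ⟨_, h.isDecomp (simplexFace_mono h.1 hz)⟩

theorem HasLocation.isSimplexTile (hd : 2 ≤ d) {C : Set (Fin d → ℝ)} {x : Fin d → ℕ}
    (h : HasLocation C x) : IsSimplexTile C := by
  obtain ⟨k, rfl⟩ : ∃ k, d = k + 1 := ⟨d - 1, by omega⟩
  refine ⟨k, ⟨fun i => (fun i => (x i : ℝ)) +ᵥ (Pi.single i 1 : Fin (k + 1) → ℝ), ?_⟩, ?_⟩
  · rw [affineIndependent_iff]
    intro s w hw hsum i hi
    simp only [vadd_eq_add, smul_add, Finset.sum_add_distrib, ← Finset.sum_smul, hw, zero_smul,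
      zero_add] at hsum
    have h1 := congrFun hsum i
    simpa [Finset.sum_apply, Pi.single_apply, hi] using h1
  · rw [h, ← convexHull_rangle_single_eq_stdSimplex, ← convexHull_vadd]
    congr 1
    ext y
    simp [Set.mem_vadd_set]

/-- Uniqueness of decompositions splits a convex combination summand by summand, and each `e_{g j}`
is extreme in its summand. -/
theorem IndepFaces.single_mem_extremePoints {A : Fin n → Finset (Fin d)} (hA : IndepFaces A)
    {g : Fin n → Fin d} (hg : ∀ j, g j ∈ A j) :
    ∑ j, (Pi.single (g j) 1 : Fin d → ℝ) ∈ (∑ j, simplexFace (A j)).extremePoints ℝ := by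
  have hgd : IsDecomp A (∑ j, (Pi.single (g j) 1 : Fin d → ℝ)) fun j => Pi.single (g j) 1 :=
    ⟨fun j => single_mem_simplexFace (hg j), rfl⟩
  refine ⟨mem_sum_simplexFace.2 ⟨_, hgd⟩, fun x hx y hy hxy => ?_⟩
  obtain ⟨p, hp⟩ := mem_sum_simplexFace.1 hx
  obtain ⟨q, hq⟩ := mem_sum_simplexFace.1 hy
  obtain ⟨a, b, ha, hb, hab, he⟩ := hxy
  have hdec : IsDecomp A (∑ j, (Pi.single (g j) 1 : Fin d → ℝ)) fun j => a • p j + b • q j := by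
    refine ⟨fun j => convex_convexHull ℝ _ (hp.1 j) (hq.1 j) ha.le hb.le hab, ?_⟩
    rw [Finset.sum_add_distrib, ← Finset.smul_sum, ← Finset.smul_sum, hp.2, hq.2, he]
  have heq := hA.decomp_unique hgd hdec
  rw [← hp.2]
  refine Finset.sum_congr rfl fun j _ => eq_single_of_support (hp.1 j) fun i hi => ?_
  by_contra hne
  have h1 := congrFun (congrFun heq j) i
  have h2 : 0 < p j i := lt_of_le_of_ne ((mem_simplexFace.1 (hp.1 j)).1 i) hi.symm
  have h3 : 0 ≤ q j i := (mem_simplexFace.1 (hq.1 j)).1 i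
  simp only [Pi.single_eq_of_ne hne, Pi.add_apply, Pi.smul_apply, smul_eq_mul] at h1
  have h4 : 0 < a * p j i + b * q j i := by positivity
  linarith

/-- At most one summand of a simplex tile is not a point. -/
theorem IndepFaces.eq_of_nontrivial {A : Fin n → Finset (Fin d)} (hA : IndepFaces A)
    (hne : ∀ j, (A j).Nonempty) (hs : IsSimplexTile (∑ j, simplexFace (A j))) {j₁ j₂ : Fin n}
    (h₁ : (A j₁).Nontrivial) (h₂ : (A j₂).Nontrivial) : j₁ = j₂ := by
  by_contra hj
  obtain ⟨k, s, hks⟩ := hs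
  choose g hg using hne
  obtain ⟨a, ha, a', ha', haa⟩ := h₁
  obtain ⟨b, hb, b', hb', hbb⟩ := h₂
  set G : Fin d → Fin d → Fin n → Fin d := fun x y =>
    Function.update (Function.update g j₁ x) j₂ y with hG
  have hGA : ∀ x ∈ A j₁, ∀ y ∈ A j₂, ∀ j, G x y j ∈ A j := by
    intro x hx y hy j
    by_cases h2 : j = j₂
    · subst h2; simpa [hG] using hy
    · simp only [hG, Function.update_of_ne h2]
      by_cases h1 : j = j₁
      · subst h1; simpa using hx
      · rw [Function.update_of_ne h1]; exact hg j
  have hpt : ∀ x ∈ A j₁, ∀ y ∈ A j₂, ∃ i, s.points i = ∑ j, Pi.single (G x y j) 1 := by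
    intro x hx y hy
    have h := hA.single_mem_extremePoints (hGA x hx y hy)
    rw [hks] at h
    obtain ⟨i, hi⟩ := extremePoints_convexHull_subset h
    exact ⟨i, hi⟩
  have hsum : ∀ x y, ∑ j, (Pi.single (G x y j) 1 : Fin d → ℝ) + Pi.single (g j₁) 1 +
      Pi.single (g j₂) 1 = ∑ j, Pi.single (g j) 1 + Pi.single x 1 + Pi.single y 1 := by
    intro x y
    have e1 := sum_single_update (R := ℝ) (Function.update g j₁ x) (Finset.mem_univ j₂) y
    have e2 := sum_single_update (R := ℝ) g (Finset.mem_univ j₁) x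
    rw [Function.update_of_ne (Ne.symm hj)] at e1
    rw [← e2, add_right_comm _ _ (Pi.single y 1), ← e1]
    simp only [hG]
    abel
  set W : Fin d → ℝ := ∑ j, Pi.single (g j) 1 - Pi.single (g j₁) 1 - Pi.single (g j₂) 1 with hW
  have hsum' : ∀ x y, ∑ j, (Pi.single (G x y j) 1 : Fin d → ℝ) =
      W + Pi.single x 1 + Pi.single y 1 := by
    intro x y
    have := hsum x y
    rw [add_assoc, ← eq_sub_iff_add_eq] at this
    rw [this, hW]
    abel
  obtain ⟨i₁, e₁⟩ := hpt a ha b hb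
  obtain ⟨i₂, e₂⟩ := hpt a' ha' b' hb'
  obtain ⟨i₃, e₃⟩ := hpt a ha b' hb'
  obtain ⟨i₄, e₄⟩ := hpt a' ha' b hb
  rw [hsum'] at e₁ e₂ e₃ e₄
  have h13 : i₁ ≠ i₃ := by
    rintro rfl
    rw [e₁] at e₃
    exact hbb (single_injective (add_left_cancel e₃))
  have h14 : i₁ ≠ i₄ := by
    rintro rfl
    rw [e₁] at e₄
    exact haa (single_injective (add_left_cancel (add_right_cancel e₄)))
  -- Varying two summands gives a parallelogram of extreme points, hence of simplex vertices, and so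
  -- an affine relation. Its coefficient at `i₁` is at least `1`, even if `i₂` were equal to `i₁`.
  have key := (affineIndependent_iff.1 s.independent) Finset.univ
    (Pi.single i₁ 1 + Pi.single i₂ 1 - Pi.single i₃ 1 - Pi.single i₄ 1) (by
      simp [Finset.sum_sub_distrib, Finset.sum_add_distrib]) (by
      simp only [Pi.sub_apply, Pi.add_apply, sub_smul, add_smul, Finset.sum_sub_distrib,
        Finset.sum_add_distrib, Pi.single_apply, ite_smul, one_smul, zero_smul,
        Finset.sum_ite_eq', Finset.mem_univ, if_true, e₁, e₂, e₃, e₄]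
      abel) i₁ (Finset.mem_univ _)
  have h0 : (0 : ℝ) ≤ (Pi.single i₂ (1 : ℝ) : Fin (k + 1) → ℝ) i₁ :=
    (Pi.single_nonneg.2 zero_le_one : (0 : Fin (k + 1) → ℝ) ≤ Pi.single i₂ 1) _
  simp only [Pi.sub_apply, Pi.add_apply, Pi.single_eq_same, Pi.single_eq_of_ne h13,
    Pi.single_eq_of_ne h14] at key
  linarith

theorem finrank_vectorSpan_simplexFace_lt {A : Finset (Fin d)} (hA : A.Nonempty) :
    Module.finrank ℝ (vectorSpan ℝ (simplexFace A)) < A.card := by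
  have h : vectorSpan ℝ (simplexFace A) =
      vectorSpan ℝ ((fun j => (Pi.single j (1 : ℝ) : Fin d → ℝ)) '' (A : Set (Fin d))) := by
    rw [simplexFace, ← direction_affineSpan, affineSpan_convexHull, direction_affineSpan]
  have hc : A.card = (A.card - 1) + 1 := by have := hA.card_pos; omega
  have := finrank_vectorSpan_image_finset_le ℝ (fun j => (Pi.single j (1 : ℝ) : Fin d → ℝ)) A hc
  rw [Finset.coe_image] at this
  rw [h]
  omega

/-- The dimensions add up to `d - 1 ≥ 1` and at most one summand is not a point, so that summand has
dimension `d - 1` and all `d` vertices. -/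
theorem IsFineMixedSubdivision.exists_location {S : Set (Set (Fin d → ℝ))}
    (hS : IsFineMixedSubdivision n d S) (hd : 2 ≤ d) {C : Set (Fin d → ℝ)} (hC : C ∈ S)
    (hs : IsSimplexTile C) : ∃ u, HasFace n S Finset.univ u ∧ HasLocation C u := by
  obtain ⟨A, hne, hind, hdim, rfl⟩ := hS.cell C hC
  have hA : IndepFaces A := indepFaces_of_iSupIndep hne hind
  have hlt := fun j => finrank_vectorSpan_simplexFace_lt (hne j)
  have hex : ∃ j₀, Module.finrank ℝ (vectorSpan ℝ (simplexFace (A j₀))) ≠ 0 := by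
    by_contra! h
    simp only [h, Finset.sum_const_zero] at hdim
    omega
  obtain ⟨j₀, hj₀⟩ := hex
  have hnt : (A j₀).Nontrivial := by
    rw [← Finset.one_lt_card_iff_nontrivial]
    have := hlt j₀
    omega
  have hzero : ∀ j ≠ j₀, Module.finrank ℝ (vectorSpan ℝ (simplexFace (A j))) = 0 := by
    intro j hj
    have h1 : ¬ (A j).Nontrivial := fun h => hj (hA.eq_of_nontrivial hne hs h hnt)
    rw [← Finset.one_lt_card_iff_nontrivial] at h1
    have := hlt j
    omega
  rw [Finset.sum_eq_single j₀ (fun j _ hj => hzero j hj) (by simp)] at hdim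
  have huniv : A j₀ = Finset.univ := by
    rw [← Finset.card_eq_iff_eq_univ, Fintype.card_fin]
    have h1 := hlt j₀
    have h2 := Finset.card_le_univ (A j₀)
    rw [Fintype.card_fin] at h2
    omega
  choose f hf using hne
  have hface : FaceAt A Finset.univ (∑ j ∈ Finset.univ.erase j₀, Pi.single (f j) 1) j₀ f :=
    ⟨huniv.ge, fun j _ => hf j, rfl⟩
  exact ⟨_, ⟨A, j₀, f, ⟨hA, hC⟩, hface⟩, hface.hasLocation hA⟩

theorem IsFineMixedSubdivision.locations_eq {S : Set (Set (Fin d → ℝ))}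
    (hS : IsFineMixedSubdivision n d S) (hd : 2 ≤ d) :
    {x | ∃ C ∈ S, IsSimplexTile C ∧ HasLocation C x} = facesAbove n S Finset.univ 0 := by
  ext x
  constructor
  · rintro ⟨C, hC, hs, hx⟩
    obtain ⟨u, hu, hCu⟩ := hS.exists_location hd hC hs
    rw [hx.unique hd hCu]
    exact ⟨hu, fun _ => Nat.zero_le _, fun i hi => absurd (Finset.mem_univ i) hi⟩
  · rintro ⟨⟨A, j₀, f, hA, h⟩, -⟩
    exact ⟨_, hA.2, (h.hasLocation hA.1).isSimplexTile hd, h.hasLocation hA.1⟩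

theorem facesAbove_univ_inter_Ici {S : Set (Set (Fin d → ℝ))} (v : Fin d → ℕ) :
    facesAbove n S Finset.univ 0 ∩ Set.Ici v = facesAbove n S Finset.univ v := by
  ext u
  constructor
  · rintro ⟨⟨h1, -, -⟩, h2⟩
    exact ⟨h1, h2, fun i hi => absurd (Finset.mem_univ i) hi⟩
  · rintro ⟨h1, h2, -⟩
    exact ⟨⟨h1, fun _ => Nat.zero_le _, fun i hi => absurd (Finset.mem_univ i) hi⟩, h2⟩

/-- The bound at `v = 0` limits every independent set to `n` points, so no independent set properly
contains one with `n`. -/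
theorem simplexMatroid_isBase_of_ncard {I : Set (Fin d → ℕ)} (hI : SimplexIndep n d I)
    (hn : n ≤ I.ncard) : (simplexMatroid n d).IsBase I := by
  rw [Matroid.isBase_iff_maximal_indep]
  refine ⟨hI, fun J hJ hIJ => ?_⟩
  have hJ' : SimplexIndep n d J := hJ
  have h1 := hJ'.ncard_le 0
  have h0 : J ∩ Set.Ici 0 = J := Set.inter_eq_left.2 fun x _ i => Nat.zero_le (x i)
  rw [h0] at h1
  simp only [Pi.zero_apply, Finset.sum_const_zero, Nat.sub_zero] at h1
  exact (Set.eq_of_subset_of_ncard_le hIJ (h1.trans hn)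
    ((simplexPoints_finite n d).subset hJ'.1)).ge

end Locations

theorem proposition8p2 (n d : ℕ) (hn : 1 ≤ n) (hd : 2 ≤ d) (S : Set (Set (Fin d → ℝ)))
    (hS : IsFineMixedSubdivision n d S) :
    {C ∈ S | IsSimplexTile C}.ncard = n ∧
    (∀ C ∈ S, IsSimplexTile C → ∃! x : Fin d → ℕ, HasLocation C x) ∧
    (simplexMatroid n d).IsBase {x | ∃ C ∈ S, IsSimplexTile C ∧ HasLocation C x} := by
  have hex : ∀ C ∈ S, IsSimplexTile C → ∃ x : Fin d → ℕ, HasLocation C x := fun C hC hs =>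
    (hS.exists_location hd hC hs).imp fun _ h => h.2
  have hle : ∀ v : Fin d → ℕ,
      (facesAbove n S Finset.univ 0 ∩ Set.Ici v).ncard ≤ n - ∑ i, v i := fun v => by
    rw [facesAbove_univ_inter_Ici]; exact hS.ncard_facesAbove_le hd v
  have hge := hS.le_ncard_facesAbove hd
  have hcard : (facesAbove n S Finset.univ 0).ncard = n := by
    refine le_antisymm ?_ hge
    simpa using hS.ncard_facesAbove_le hd 0
  refine ⟨?_, fun C hC hs => ?_, ?_⟩
  · have himage : {C ∈ S | IsSimplexTile C} =
        (fun x : Fin d → ℕ => (fun i => (x i : ℝ)) +ᵥ stdSimplex ℝ (Fin d)) ''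
          {x | ∃ C ∈ S, IsSimplexTile C ∧ HasLocation C x} := by
      ext C
      constructor
      · rintro ⟨hC, hs⟩
        obtain ⟨x, hx⟩ := hex C hC hs
        exact ⟨x, ⟨C, hC, hs, hx⟩, hx.symm⟩
      · rintro ⟨x, ⟨C', hC', hs, hx⟩, rfl⟩
        have hx' : C' = (fun i => (x i : ℝ)) +ᵥ stdSimplex ℝ (Fin d) := hx
        rw [hx'] at hC' hs
        exact ⟨hC', hs⟩
    have hinj : Function.Injective
        (fun x : Fin d → ℕ => (fun i => (x i : ℝ)) +ᵥ stdSimplex ℝ (Fin d)) := fun x y hxy =>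
      HasLocation.unique hd (C := (fun i => (x i : ℝ)) +ᵥ stdSimplex ℝ (Fin d)) rfl hxy
    rw [himage, Set.ncard_image_of_injective _ hinj, hS.locations_eq hd, hcard]
  · obtain ⟨x, hx⟩ := hex C hC hs
    exact ⟨x, hx, fun y hy => hy.unique hd hx⟩
  · rw [hS.locations_eq hd]
    exact simplexMatroid_isBase_of_ncard
      (simplexIndep_of_ncard_le (fun u hu => hu.1.sum_add_one) hle) hge
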